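/- **Setting.** Write $[q]=\{0,\dots,q-1\}$. For $j\in[D]$ let $\nu_j$ be a probability measure on $\mathcal D_j\subset\mathbb R$ and let $\{T_{j;n}:\mathcal D_j\to\mathbb C\}_{n\in[M]}$ be a bounded orthonormal system with respect to $\nu_j$ (measurable, uniformly bounded functions, orthonormal in $L^2(\mathcal D_j,\nu_j)$). Let $\mathcal D=\times_{j\in[D]}\mathcal D_j$, and for $\mathbf n\in[M]^D$ let $T_{\mathbf n}(\mathbf x)=\prod_{j\in[D]}T_{j;n_j}(x_j)$. Let $1\le d\le D$ and $\mathcal I=\{\mathbf n\in[M]^D:\ \mathbf n\text{ has at most }d\text{ nonzero entries}\}$. Let $s\ge1$ be an integer with $2s\le N:=\binom Dd M^d$, and let $\mathcal H_{2s}$ be the set of functions $h=\sum_{\mathbf n\in\mathcal I}(r_h)_{\mathbf n}T_{\mathbf n}$ whose coefficient vector $\mathbf r_h$ has at most $2s$ nonzero entries (extended by $0$ to $[M]^D$). For $j\in[D]$, $\widetilde n\in[M]$ and $\mathbf r\in\mathbb C^{[M]^D}$, let $\mathbf r_{j;\widetilde n}\in\mathbb C^{[M]^{D-1}}$ be the vector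 of the entries $r_{\mathbf n}$ with $n_j=\widetilde n$, indexed by $(n_i)_{i\ne j}$. Let $m\in\mathbb N$ and, for $j\in[D]$, $\ell\in[m]$, let $\mathbf x_{j,\ell}\in\times_{i\neq j}\mathcal D_i$ be (any fixed) sampling points. Let $\widetilde A_j\in\mathbb C^{m\times[M]^{D-1}}$ have the entries $(\widetilde A_j)_{\ell,\mathbf k}=\frac1{\sqrt m}\prod_{i\ne j}T_{i;k_i}((\mathbf x_{j,\ell})_i)$. Its restricted forms are, for $\widetilde n\in[M]$, the submatrices of the columns $\mathbf k$ for which the vector obtained from $\mathbf k$ by inserting $\widetilde n$ as $j$-th entry lies in $\mathcal I$. Assume that for some $\delta\in(0,7/16)$ the restricted isometry constants $\delta_{2s}$ of all of these restricted matrices ($j\in[D]$, $\widetilde n\in[M]$) are at most $\delta$. (The $q$-th restricted isometry constant of a matrix $A$ is the smallest $\delta\ge0$ with $(1-\delta)\|\mathbf c\|_2^2\le\|A\mathbf c\|_2^2\le(1+\delta)\|\mathbf c\|_2^2$ for all $\mathbf c$ with at most $q$ nonzero entries.) Let $L\in\mathbb N$, let $g^k_\ell$ ($k\in[L]$, $\ell\in[m]$)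 be i.i.d. standard real Gaussian variables, let $\mathbf g^k=(g^k_\ell)_{\ell\in[m]}$, and define the proxy functions $h_{j;k}:\mathcal D_j\to\mathbb C$ by $$h_{j;k}(x)=\frac1{\sqrt m}\sum_{\ell\in[m]}g^k_\ell\,h([x,\mathbf x_{j,\ell}]),$$ where $[x,\mathbf x_{j,\ell}]\in\mathcal D$ is $\mathbf x_{j,\ell}$ with $x$ inserted as $j$-th coordinate. Probabilities are with respect to the weights $g^k_\ell$. **Theorem.** There are absolute constants $\alpha'>0$, $\gamma'>0$ and $m_0\in\mathbb N$ such that the following holds in every such setting. (0) The constant $\alpha'$ satisfies $\mathbb P\big[\|h_{j;k}\|^2_{L^2(\mathcal D_j,\nu_j)}\ge\alpha'\|\mathbf r_h\|_2^2\big]\le 0.025$ for all $h\in\mathcal H_{2s}$ with $\mathbf r_h\ne0$, all $j\in[D]$ and all $k\in[L]$, for every $L\in\mathbb N$. Moreover, let $p\in(0,1)$, let $L$ be odd, and assume $$L\ \ge\ \gamma'\, s\, d\,\log\left(\frac{DM}{\sqrt[d]{s\,d\,p^{1/s}}}\right).$$ (1) If $m\ge m_0$, then with probability greater than $1-p$,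 simultaneously for all $(h,j,\widetilde n)\in\mathcal H_{2s}\times[D]\times[M]$, more than $L/2$ of the $k\in[L]$ satisfy all three of: $\|h_{j;k}\|^2_{L^2(\mathcal D_j,\nu_j)}\le\alpha'\|\mathbf r_h\|_2^2$; $\ \frac{\sqrt{23}}{12}\|(\mathbf r_h)_{j;\widetilde n}\|_2\le|\langle h_{j;k},T_{j;\widetilde n}\rangle_{(\mathcal D_j,\nu_j)}|\le\frac94\|(\mathbf r_h)_{j;\widetilde n}\|_2$; $\ \frac12m\le\|\mathbf g^k\|_2^2\le\frac32m$. (2) With probability greater than $1-p$, simultaneously for all $(h,j,\widetilde n)\in\mathcal H_{2s}\times[D]\times[M]$, more than $L/2$ of the $k\in[L]$ satisfy both $$\|h_{j;k}\|^2_{L^2(\mathcal D_j,\nu_j)}\le(\alpha'+1)\|\mathbf r_h\|_2^2\quad\text{and}\quad\tfrac13\|(\mathbf r_h)_{j;\widetilde n}\|_2\le\big|\langle h_{j;k},T_{j;\widetilde n}\rangle_{(\mathcal D_j,\nu_j)}\big|\le\tfrac92\|(\mathbf r_h)_{j;\widetilde n}\|_2 .$$ -/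

import Mathlib

open MeasureTheory ProbabilityTheory

namespace BOP

/-- `(T_k)_{k ∈ [M]}` is a bounded orthonormal system with respect to `σ`. -/
structure IsBOS {E : Type*} [MeasurableSpace E] {M : ℕ} (σ : Measure E) (T : Fin M → E → ℂ) :
    Prop where
  measurable : ∀ k, Measurable (T k)
  bounded : ∃ K : ℝ, ∀ k x, ‖T k x‖ ≤ K
  orthonormal : ∀ k l, ∫ x, T k x * (starRingEnd ℂ) (T l x) ∂σ = if k = l then 1 else 0

/-- The Euclidean norm `‖c‖₂` of a vector. -/
noncomputable def l2norm {ι 𝕜 : Type*} [Fintype ι] [RCLike 𝕜] (c : ι → 𝕜) : ℝ :=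
  ‖(WithLp.toLp 2 c : EuclideanSpace 𝕜 ι)‖

/-- `c` has at most `s` nonzero entries. -/
def IsSparse {ι : Type*} (s : ℕ) (c : ι → ℂ) : Prop := (Function.support c).ncard ≤ s

/-- The `s`-th restricted isometry constant `δ_s` of a matrix. -/
noncomputable def ric {ι κ : Type*} [Fintype ι] [Fintype κ] (s : ℕ) (A : Matrix ι κ ℂ) : ℝ :=
  sInf {δ : ℝ | 0 ≤ δ ∧ ∀ c : κ → ℂ, IsSparse s c →
    (1 - δ) * l2norm c ^ 2 ≤ l2norm (A.mulVec c) ^ 2 ∧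
      l2norm (A.mulVec c) ^ 2 ≤ (1 + δ) * l2norm c ^ 2}

/-- Insert the value `a` at coordinate `j` into a vector `b` indexed by `[D] \ {j}`. -/
def insertCoord {D : ℕ} {β : Fin D → Type*} (j : Fin D) (a : β j)
    (b : ∀ i : {i : Fin D // i ≠ j}, β i) : ∀ i, β i :=
  (Equiv.piSplitAt j β).symm (a, b)

/-- The index set `𝓘 = {n ∈ [M]^D : ‖n‖₀ ≤ d}`. -/
def indexSet (D M d : ℕ) : Set (Fin D → Fin M) :=
  {n | {i | (n i : ℕ) ≠ 0}.ncard ≤ d}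

noncomputable instance {D M d : ℕ} (n : Fin D → Fin M) : Decidable (n ∈ indexSet D M d) :=
  Classical.propDecidable _

section

variable {D M m L : ℕ} {𝒟 : Fin D → Set ℝ}

/-- The product basis function `T_n(x) = ∏_j T_{j;n_j}(x_j)`. -/
noncomputable def prodBasis (T : ∀ j, Fin M → 𝒟 j → ℂ) (n : Fin D → Fin M) (x : ∀ j, 𝒟 j) : ℂ :=
  ∏ j, T j (n j) (x j)

/-- The function `h = ∑_n r_n T_n` with coefficient vector `r`. -/
noncomputable def expansion (T : ∀ j, Fin M → 𝒟 j → ℂ) (r : (Fin D → Fin M) → ℂ)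
    (x : ∀ j, 𝒟 j) : ℂ :=
  ∑ n, r n * prodBasis T n x

/-- The set of `s`-sparse coefficient vectors supported in `𝓘`. -/
def sparseCoeffs (D M d s : ℕ) : Set ((Fin D → Fin M) → ℂ) :=
  {r | Function.support r ⊆ indexSet D M d ∧ IsSparse s r}

/-- The vector `r_{j;ñ} ∈ ℂ^{[M]^{D-1}}` of the entries of `r` whose `j`-th index is `ñ`. -/
def slice (r : (Fin D → Fin M) → ℂ) (j : Fin D) (n : Fin M) :
    ({i : Fin D // i ≠ j} → Fin M) → ℂ :=
  fun k => r (insertCoord (β := fun _ => Fin M) j n k)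

/-- The normalized sampling matrix `Ã_j` of the points `x_{j,ℓ}`. -/
noncomputable def samplingMatrix (T : ∀ j, Fin M → 𝒟 j → ℂ) (j : Fin D)
    (X : Fin m → ∀ i : {i : Fin D // i ≠ j}, 𝒟 i) :
    Matrix (Fin m) ({i : Fin D // i ≠ j} → Fin M) ℂ :=
  fun l k => (1 / (Real.sqrt m : ℂ)) * ∏ i : {i : Fin D // i ≠ j}, T i (k i) (X l i)

/-- The restricted form of `Ã_j`: only the columns on which `r_{j;ñ}` can be nonzero are kept when
`r` is supported in `𝓘`. -/
noncomputable def restrictedMatrix (d : ℕ) (T : ∀ j, Fin M → 𝒟 j → ℂ) (j : Fin D)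
    (X : Fin m → ∀ i : {i : Fin D // i ≠ j}, 𝒟 i) (n : Fin M) :
    Matrix (Fin m) {k : {i : Fin D // i ≠ j} → Fin M //
      insertCoord (β := fun _ => Fin M) j n k ∈ indexSet D M d} ℂ :=
  (samplingMatrix T j X).submatrix id Subtype.val

/-- The proxy function `h_{j;k}(x) = m^{-1/2} ∑_ℓ g_ℓ h([x, x_{j,ℓ}])`, for the weights
`g = g^k`. -/
noncomputable def proxy (h : (∀ j, 𝒟 j) → ℂ) (j : Fin D)
    (X : Fin m → ∀ i : {i : Fin D // i ≠ j}, 𝒟 i) (g : Fin m → ℝ) (x : 𝒟 j) : ℂ :=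
  (1 / (Real.sqrt m : ℂ)) *
    ∑ l, (g l : ℂ) * h (insertCoord (β := fun i => 𝒟 i) j x (X l))

/-- `‖f‖²` in `L²(E, σ)`. -/
noncomputable def energy {E : Type*} [MeasurableSpace E] (σ : Measure E) (f : E → ℂ) : ℝ :=
  ∫ x, ‖f x‖ ^ 2 ∂σ

/-- `⟨f, g⟩` in `L²(E, σ)`, linear in `f`. -/
noncomputable def innerL2 {E : Type*} [MeasurableSpace E] (σ : Measure E) (f g : E → ℂ) : ℂ :=
  ∫ x, f x * (starRingEnd ℂ) (g x) ∂σ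

/-- The law of the family `(g^k_ℓ)_{k ∈ [L], ℓ ∈ [m]}` of i.i.d. standard Gaussian weights. -/
noncomputable def gaussianWeights (L m : ℕ) : Measure (Fin L → Fin m → ℝ) :=
  Measure.pi fun _ => Measure.pi fun _ => gaussianReal 0 1

open Classical in
/-- The indicator `E_{h,j,ñ,k}`, for `h` with coefficient vector `r` and for the weights
`g = g^k`. -/
noncomputable def goodIndicator (α : ℝ) (ν : ∀ j, Measure (𝒟 j)) (T : ∀ j, Fin M → 𝒟 j → ℂ)
    (X : ∀ j : Fin D, Fin m → ∀ i : {i : Fin D // i ≠ j}, 𝒟 i) (r : (Fin D → Fin M) → ℂ)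
    (j : Fin D) (n : Fin M) (g : Fin m → ℝ) : ℕ :=
  if energy (ν j) (proxy (expansion T r) j (X j) g) ≤ α * l2norm r ^ 2 ∧
      (Real.sqrt 23 / 12 * l2norm (slice r j n) ≤
          ‖innerL2 (ν j) (proxy (expansion T r) j (X j) g) (T j n)‖ ∧
        ‖innerL2 (ν j) (proxy (expansion T r) j (X j) g) (T j n)‖ ≤
          9 / 4 * l2norm (slice r j n)) ∧
      ((m : ℝ) / 2 ≤ l2norm g ^ 2 ∧ l2norm g ^ 2 ≤ 3 / 2 * m)
  then 1 else 0

end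

end BOP

/-! ### Exponential moments and Chernoff bounds for product measures. -/

open scoped ENNReal NNReal

/-! Expand the proxy function in the univariate system: its `n`-th coefficient is the Gaussian
linear form `∑ l, g l * (Ã_j r_{j;n}) l` (`proxyCoeff`). By orthonormality the inner product with
`T_{j;n}` is this coefficient and the energy is the sum of the squared moduli of all coefficients.
The restricted isometry bound puts the variance of the form between `9/16` and `23/16` of
`‖r_{j;n}‖²`. All that remains concerns Gaussian forms.

For one fixed vector, the modulus of the form leaves `[0.4, 2.24] * ‖r_{j;n}‖` with probability at
most `0.495 < 1/2` (`stdGaussianPi_norm_linear_notMem_le`): a density bound handles small values,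
and a convex comparison with a single squared Gaussian handles large ones. By `exists_chernoff` the
fraction of bad `k` then reaches `0.4965` only with probability exponentially small in `L`. The same
comparison gives exponential moments of the energy, so the energies summed over `k` stay below `16 *
L` except with probability `exp (-L)`.

Uniformity comes from a union bound over supports and over a `1e-7`-net of the unit ball on each
support. The passage from the net to all vectors is not made for each `k` separately. The summed
energy is the squared norm of one linear map on coefficient vectors, which a net controls
(`norm_le_of_net`); a small perturbation therefore has a small square sum over `k`, and by Markov it
can spoil only a tiny fraction of the indices (`ncard_coeff_bad_le`). Since lower bounds are
relative to a slice that may be far smaller than `r`, they are proved after isolating and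
normalizing that slice. The energy bound for most `k` is the same counting argument.

The entropy of supports, nets and pairs `(j, n)` is of order `s * log ((DM)^d / (sd))`, and the
assumption on `L` dominates this plus `log (1/p)` (`union_bound_lt`). The fractions lost, `0.4975`,
`0.001` for the energy and, in the first assertion, `0.001` for the norm of the weights, sum to less
than `1/2`. -/

lemma lintegral_pi_prod {ι Ω : Type*} [Fintype ι] [MeasurableSpace Ω] (μ : Measure Ω)
    [IsProbabilityMeasure μ] (f : Ω → ℝ≥0∞) (hf : Measurable f) :
    ∫⁻ g : ι → Ω, ∏ i, f (g i) ∂(Measure.pi fun _ => μ) = (∫⁻ x, f x ∂μ) ^ Fintype.card ι := by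
  have hind : iIndepFun (fun (i : ι) (g : ι → Ω) => f (g i)) (Measure.pi fun _ => μ) :=
    iIndepFun_pi (X := fun _ => f) fun _ => hf.aemeasurable
  rw [lintegral_prod_eq_prod_lintegral_of_indepFun Finset.univ _ hind
    (fun i => hf.comp (measurable_pi_apply i))]
  rw [Finset.prod_congr rfl fun i _ =>
    (measurePreserving_eval (fun _ : ι => μ) i).lintegral_comp hf]
  simp

/-- The exponential Markov inequality for sums of i.i.d. variables. -/
lemma measure_pi_sum_ge_le {ι Ω : Type*} [Fintype ι] [MeasurableSpace Ω] (μ : Measure Ω)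
    [IsProbabilityMeasure μ] (f : Ω → ℝ) (hf : Measurable f) (β : ℝ) {A : ℝ} (hA0 : 0 ≤ A)
    (hA : ∫⁻ x, ENNReal.ofReal (Real.exp (f x)) ∂μ ≤ ENNReal.ofReal A) :
    (Measure.pi fun _ : ι => μ) {g | β * Fintype.card ι ≤ ∑ i, f (g i)} ≤
      ENNReal.ofReal ((Real.exp (-β) * A) ^ Fintype.card ι) := by
  set F : Ω → ℝ≥0∞ := fun x => ENNReal.ofReal (Real.exp (-β)) * ENNReal.ofReal (Real.exp (f x))
  have hF : Measurable F := by fun_prop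
  have hsub : {g : ι → Ω | β * Fintype.card ι ≤ ∑ i, f (g i)} ⊆ {g | 1 ≤ ∏ i, F (g i)} := by
    intro g hg
    simp only [Set.mem_ofPred_eq] at hg ⊢
    have : ∏ i, F (g i) = ENNReal.ofReal (Real.exp (∑ i, f (g i) - β * Fintype.card ι)) := by
      simp only [F]
      rw [Finset.prod_congr rfl fun i _ => (ENNReal.ofReal_mul (Real.exp_pos _).le).symm,
        ← ENNReal.ofReal_prod_of_nonneg fun i _ => by positivity]
      congr 1
      rw [Finset.prod_congr rfl fun i _ => (Real.exp_add _ _).symm, ← Real.exp_sum,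
        Finset.sum_add_distrib]
      simp only [Finset.sum_const, Finset.card_univ, nsmul_eq_mul]
      congr 1; ring
    rw [this, ENNReal.one_le_ofReal]
    exact Real.one_le_exp (by linarith)
  calc _ ≤ (Measure.pi fun _ : ι => μ) {g | 1 ≤ ∏ i, F (g i)} := measure_mono hsub
    _ ≤ ∫⁻ g : ι → Ω, ∏ i, F (g i) ∂(Measure.pi fun _ => μ) := by
      have := mul_meas_ge_le_lintegral (μ := Measure.pi fun _ : ι => μ)
        (f := fun g : ι → Ω => ∏ i, F (g i)) (by fun_prop) 1
      simpa using this
    _ = (∫⁻ x, F x ∂μ) ^ Fintype.card ι := lintegral_pi_prod μ F hF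
    _ ≤ (ENNReal.ofReal (Real.exp (-β)) * ENNReal.ofReal A) ^ Fintype.card ι := by
      gcongr
      simp only [F]
      rw [lintegral_const_mul _ (by fun_prop)]
      gcongr
    _ = _ := by
      rw [← ENNReal.ofReal_mul (Real.exp_pos _).le]
      rw [ENNReal.ofReal_pow (mul_nonneg (Real.exp_pos _).le hA0)]

/-- For small `θ` the exponent is at most `-θ * (β - q) + q * θ ^ 2`; the linear gain beats the
quadratic loss. -/
lemma chernoff_constant {q β : ℝ} (hq : 0 ≤ q) (hqβ : q < β) :
    ∃ θ > 0, ∃ c > 0, Real.exp (-(θ * β)) * (1 + q * (Real.exp θ - 1)) ≤ Real.exp (-c) := by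
  -- The cap `1` permits `exp θ - 1 ≤ θ + θ ^ 2`; the other term keeps the quadratic loss below half
  -- of the linear gain.
  set θ : ℝ := min 1 ((β - q) / (2 * (q + 1)))
  have hθ : 0 < θ := lt_min one_pos (by apply div_pos <;> linarith)
  have hθ1 : θ ≤ 1 := min_le_left _ _
  have hθ2 : θ * (q + 1) ≤ (β - q) / 2 := by
    have := min_le_right 1 ((β - q) / (2 * (q + 1)))
    calc θ * (q + 1) ≤ (β - q) / (2 * (q + 1)) * (q + 1) := by gcongr
      _ = _ := by field_simp
  refine ⟨θ, hθ, θ * ((β - q) / 2), by apply mul_pos hθ; linarith, ?_⟩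
  have h1 : Real.exp θ - 1 ≤ θ + θ ^ 2 := by
    have := Real.abs_exp_sub_one_sub_id_le (x := θ) (by rw [abs_of_pos hθ]; exact hθ1)
    have := le_of_abs_le this
    linarith
  calc Real.exp (-(θ * β)) * (1 + q * (Real.exp θ - 1))
      ≤ Real.exp (-(θ * β)) * Real.exp (q * (θ + θ ^ 2)) := by
        gcongr
        have := Real.add_one_le_exp (q * (θ + θ ^ 2))
        have : q * (Real.exp θ - 1) ≤ q * (θ + θ ^ 2) := by gcongr
        linarith
    _ ≤ _ := by
        rw [← Real.exp_add]
        apply Real.exp_le_exp.2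
        nlinarith

/-- A Chernoff bound: if an event has probability at most `q < β`, then the probability that at
least a fraction `β` of `L` independent copies occur is exponentially small in `L`. -/
lemma exists_chernoff {q β : ℝ} (hq : 0 ≤ q) (hqβ : q < β) :
    ∃ c > 0, ∀ {Ω : Type} [MeasurableSpace Ω] (μ : Measure Ω) [IsProbabilityMeasure μ]
      (B : Set Ω) (L : ℕ), MeasurableSet B → μ B ≤ ENNReal.ofReal q →
      (Measure.pi fun _ : Fin L => μ) {g | β * L ≤ ({k | g k ∈ B}.ncard : ℝ)} ≤
        ENNReal.ofReal (Real.exp (-(c * L))) := by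
  obtain ⟨θ, hθ, c, hc, h⟩ := chernoff_constant hq hqβ
  refine ⟨c, hc, fun {Ω} _ μ _ B L hB hμ => ?_⟩
  classical
  have key := measure_pi_sum_ge_le (ι := Fin L) μ (B.indicator fun _ => θ)
    (measurable_const.indicator hB) (θ * β) (A := 1 + q * (Real.exp θ - 1))
    (by nlinarith [Real.add_one_le_exp θ]) (by
      have h1 : 0 ≤ Real.exp θ - 1 := by linarith [Real.add_one_le_exp θ]
      have : ∀ x, ENNReal.ofReal (Real.exp (B.indicator (fun _ => θ) x)) =
          1 + B.indicator (fun _ => ENNReal.ofReal (Real.exp θ - 1)) x := by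
        intro x
        by_cases hx : x ∈ B
        · simp only [Set.indicator_of_mem hx]
          rw [← ENNReal.ofReal_one, ← ENNReal.ofReal_add zero_le_one h1]; congr 1; ring
        · simp [Set.indicator_of_notMem hx]
      simp_rw [this]
      rw [lintegral_add_left measurable_const, lintegral_indicator_const hB, lintegral_one,
        measure_univ, ENNReal.ofReal_add zero_le_one (mul_nonneg hq h1), ENNReal.ofReal_one,
        ENNReal.ofReal_mul hq, mul_comm (ENNReal.ofReal q)]
      gcongr)
  refine (measure_mono ?_).trans (key.trans (ENNReal.ofReal_le_ofReal ?_))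
  · intro g hg
    simp only [Set.mem_ofPred_eq, Fintype.card_fin] at hg ⊢
    have : ∑ i, B.indicator (fun _ => θ) (g i) = θ * ({k | g k ∈ B}.ncard : ℝ) := by
      simp only [Set.indicator_apply]
      rw [← Finset.sum_filter, Finset.sum_const, nsmul_eq_mul, Set.ncard_eq_toFinset_card']
      rw [mul_comm]; congr 3; ext; simp
    rw [this, mul_assoc]
    gcongr
  · have h1 : 0 ≤ Real.exp θ - 1 := by linarith [Real.add_one_le_exp θ]
    rw [Fintype.card_fin, show -(c * (L : ℝ)) = L * -c by ring, Real.exp_nat_mul]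
    gcongr

/-! ### Linear and quadratic forms in Gaussian variables. -/

/-- The law of i.i.d. standard real Gaussian variables. -/
noncomputable abbrev stdGaussianPi (ι : Type*) [Fintype ι] : Measure (ι → ℝ) :=
  Measure.pi fun _ => gaussianReal 0 1

section
variable {ι : Type*} [Fintype ι]

lemma hasGaussianLaw_stdGaussianPi : HasGaussianLaw (fun g : ι → ℝ => g) (stdGaussianPi ι) := by
  refine iIndepFun.hasGaussianLaw (X := fun (i : ι) (g : ι → ℝ) => g i) (fun i => ?_)
    (iIndepFun_pi (X := fun (_ : ι) (x : ℝ) => x) fun _ => aemeasurable_id)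
  refine ⟨?_⟩
  rw [(measurePreserving_eval (fun _ : ι => gaussianReal 0 1) i).map_eq]
  infer_instance

lemma memLp_eval_stdGaussianPi (i : ι) : MemLp (fun g : ι → ℝ => g i) 2 (stdGaussianPi ι) :=
  (hasGaussianLaw_stdGaussianPi.eval i).memLp_two

lemma integral_eval_stdGaussianPi (i : ι) : ∫ g, g i ∂(stdGaussianPi ι) = 0 := by
  have h := integral_map (μ := stdGaussianPi ι) (φ := fun g : ι → ℝ => g i) (f := fun x : ℝ => x)
    (measurable_pi_apply i).aemeasurable (by fun_prop)
  rw [(measurePreserving_eval (fun _ : ι => gaussianReal 0 1) i).map_eq] at h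
  rw [← h, integral_id_gaussianReal]

lemma covariance_eval_stdGaussianPi [DecidableEq ι] (i j : ι) :
    cov[fun g : ι → ℝ => g i, fun g => g j; stdGaussianPi ι] = if i = j then 1 else 0 := by
  split_ifs with h
  · subst h
    rw [covariance_self (measurable_pi_apply i).aemeasurable]
    have := variance_map (μ := stdGaussianPi ι) (X := id) (Y := fun g : ι → ℝ => g i)
      (by fun_prop) (measurable_pi_apply i).aemeasurable
    rw [(measurePreserving_eval (fun _ : ι => gaussianReal 0 1) i).map_eq,
      variance_id_gaussianReal] at this
    simpa using this.symm
  · exact ((iIndepFun_pi (X := fun (_ : ι) (x : ℝ) => x) fun _ => aemeasurable_id).indepFun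
      h).covariance_eq_zero (memLp_eval_stdGaussianPi i) (memLp_eval_stdGaussianPi j)

lemma covariance_linear_stdGaussianPi (a b : ι → ℝ) :
    cov[fun g : ι → ℝ => ∑ i, g i * a i, fun g => ∑ i, g i * b i; stdGaussianPi ι] =
      ∑ i, a i * b i := by
  classical
  rw [covariance_fun_sum_fun_sum (fun i => (memLp_eval_stdGaussianPi i).mul_const _)
    (fun i => (memLp_eval_stdGaussianPi i).mul_const _)]
  simp_rw [covariance_mul_const_left, covariance_mul_const_right, covariance_eval_stdGaussianPi]
  simp [mul_comm]

lemma hasGaussianLaw_linear_pair (a b : ι → ℝ) :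
    HasGaussianLaw (fun g : ι → ℝ => (∑ i, g i * a i, ∑ i, g i * b i)) (stdGaussianPi ι) := by
  let ℓ (a : ι → ℝ) : (ι → ℝ) →L[ℝ] ℝ := ∑ i, a i • ContinuousLinearMap.proj i
  have := hasGaussianLaw_stdGaussianPi.map_fun ((ℓ a).prod (ℓ b))
  refine this.congr (Filter.Eventually.of_forall fun g => ?_)
  simp [ℓ, mul_comm]

lemma map_linear_stdGaussianPi (a : ι → ℝ) :
    (stdGaussianPi ι).map (fun g => ∑ i, g i * a i) =
      gaussianReal 0 (∑ i, a i ^ 2).toNNReal := by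
  rw [(hasGaussianLaw_linear_pair a a).fst.map_eq_gaussianReal]
  congr 2
  · rw [integral_finsetSum _ fun i _ =>
      ((memLp_eval_stdGaussianPi i).integrable one_le_two).mul_const _]
    simp_rw [integral_mul_const, integral_eval_stdGaussianPi]
    simp
  · rw [← covariance_self (Measurable.aemeasurable (by fun_prop)), covariance_linear_stdGaussianPi]
    simp [sq]

/-- Jointly Gaussian variables that are uncorrelated are independent. -/
lemma map_linear_pair_stdGaussianPi (a b : ι → ℝ) (hab : ∑ i, a i * b i = 0) :
    (stdGaussianPi ι).map (fun g => (∑ i, g i * a i, ∑ i, g i * b i)) =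
      (gaussianReal 0 (∑ i, a i ^ 2).toNNReal).prod (gaussianReal 0 (∑ i, b i ^ 2).toNNReal) := by
  have h := (hasGaussianLaw_linear_pair a b).indepFun_of_covariance_eq_zero
    (by rw [covariance_linear_stdGaussianPi, hab])
  rw [(indepFun_iff_map_prod_eq_prod_map_map (Measurable.aemeasurable (by fun_prop))
    (Measurable.aemeasurable (by fun_prop))).1 h,
    map_linear_stdGaussianPi, map_linear_stdGaussianPi]

/-- A convex function of a quadratic form in Gaussian variables has a mean that is at most the mean
for the rank-one form of the same trace. -/
lemma lintegral_convex_quadratic_le {κ : Type*} [Fintype κ] (a : κ → ι → ℝ) (f : ℝ → ℝ)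
    (hf : ConvexOn ℝ Set.univ f) (hfc : Continuous f) :
    ∫⁻ g, ENNReal.ofReal (f (∑ k, (∑ i, g i * a k i) ^ 2)) ∂(stdGaussianPi ι) ≤
      ∫⁻ x, ENNReal.ofReal (f ((∑ k, ∑ i, a k i ^ 2) * x ^ 2)) ∂(gaussianReal 0 1) := by
  set τ := ∑ k, ∑ i, a k i ^ 2 with hτ
  set w : κ → ℝ := fun k => ∑ i, a k i ^ 2
  have hw : ∀ k, 0 ≤ w k := fun k => by positivity
  have hzero : ∀ k, w k = 0 → ∀ g : ι → ℝ, ∑ i, g i * a k i = 0 := by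
    intro k hk g
    have := (Finset.sum_eq_zero_iff_of_nonneg fun i _ => sq_nonneg (a k i)).1 hk
    exact Finset.sum_eq_zero fun i hi => by
      rw [pow_eq_zero_iff two_ne_zero |>.1 (this i hi), mul_zero]
  rcases (show 0 ≤ τ from Finset.sum_nonneg fun k _ => hw k).eq_or_lt with h0 | hpos
  · have hk : ∀ k, w k = 0 := fun k =>
      (Finset.sum_eq_zero_iff_of_nonneg fun k _ => hw k).1 h0.symm k (Finset.mem_univ k)
    rw [← h0]
    simp [hzero _ (hk _)]
  have hsum : ∑ k, w k / τ = 1 := by rw [← Finset.sum_div]; exact div_self hpos.ne'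
  -- Jensen with the weights `w k / τ`: after rescaling by `τ / w k` every square has the law of `τ
  -- * x ^ 2`, so all terms of the average have the same mean, whatever their dependence.
  calc ∫⁻ g, ENNReal.ofReal (f (∑ k, (∑ i, g i * a k i) ^ 2)) ∂(stdGaussianPi ι)
      ≤ ∫⁻ g, ∑ k, ENNReal.ofReal (w k / τ) *
          ENNReal.ofReal (f (τ / w k * (∑ i, g i * a k i) ^ 2)) ∂(stdGaussianPi ι) := by
        refine lintegral_mono fun g => ?_
        have h1 : ∑ k, (∑ i, g i * a k i) ^ 2 =
            ∑ k, (w k / τ) • (τ / w k * (∑ i, g i * a k i) ^ 2) := by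
          refine Finset.sum_congr rfl fun k _ => ?_
          by_cases hk : w k = 0
          · simp [hzero k hk]
          · rw [smul_eq_mul]; field_simp
        have h2 := hf.map_sum_le (t := Finset.univ) (w := fun k => w k / τ)
          (p := fun k => τ / w k * (∑ i, g i * a k i) ^ 2)
          (fun k _ => div_nonneg (hw k) hpos.le) hsum (fun _ _ => Set.mem_univ _)
        rw [h1]
        refine (ENNReal.ofReal_le_ofReal h2).trans ?_
        simp only [smul_eq_mul]
        refine (Finset.le_sum_of_subadditive _ ENNReal.ofReal_zero.le
          (fun _ _ => ENNReal.ofReal_add_le) _ _).trans ?_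
        simp [ENNReal.ofReal_mul, div_nonneg (hw _) hpos.le]
    _ = ∑ k, ENNReal.ofReal (w k / τ) *
          ∫⁻ x, ENNReal.ofReal (f (τ * x ^ 2)) ∂(gaussianReal 0 1) := by
        rw [lintegral_finsetSum _ fun k _ => by fun_prop]
        refine Finset.sum_congr rfl fun k _ => ?_
        rw [lintegral_const_mul _ (by fun_prop)]
        by_cases hk : w k = 0
        · simp [hk]
        congr 1
        have h3 := lintegral_map (μ := stdGaussianPi ι)
          (f := fun y => ENNReal.ofReal (f (τ / w k * y ^ 2))) (g := fun g => ∑ i, g i * a k i)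
          (by fun_prop) (by fun_prop)
        rw [← h3, map_linear_stdGaussianPi]
        have h4 : gaussianReal 0 (∑ i, a k i ^ 2).toNNReal =
            (gaussianReal 0 1).map (√(w k) * ·) := by
          rw [gaussianReal_map_const_mul]
          congr 1
          · simp
          · ext; simp [w, Real.sq_sqrt (hw k), Real.coe_toNNReal _ (hw k)]
        rw [h4, lintegral_map (by fun_prop) (by fun_prop)]
        refine lintegral_congr fun x => ?_
        rw [mul_pow, Real.sq_sqrt (hw k)]
        congr 2; field_simp
    _ = _ := by
        rw [← Finset.sum_mul, ← ENNReal.ofReal_sum_of_nonneg fun k _ => div_nonneg (hw k) hpos.le,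
          hsum, ENNReal.ofReal_one, one_mul]
end

/-! ### Explicit one-dimensional Gaussian integrals. -/

lemma gaussianPDFReal_zero_one (x : ℝ) :
    gaussianPDFReal 0 1 x = (√(2 * Real.pi))⁻¹ * Real.exp (-(1 / 2) * x ^ 2) := by
  rw [gaussianPDFReal]
  simp only [NNReal.coe_one, mul_one, sub_zero]
  congr 2; ring

lemma lintegral_gaussianReal (f : ℝ → ℝ≥0∞) (hf : Measurable f) :
    ∫⁻ x, f x ∂(gaussianReal 0 1) =
      ∫⁻ x, ENNReal.ofReal ((√(2 * Real.pi))⁻¹ * Real.exp (-(1 / 2) * x ^ 2)) * f x := by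
  rw [gaussianReal_of_var_ne_zero _ one_ne_zero,
    lintegral_withDensity_eq_lintegral_mul _ (measurable_gaussianPDF 0 1) hf]
  simp only [Pi.mul_apply, gaussianPDF, gaussianPDFReal_zero_one]

lemma lintegral_exp_sq_gaussianReal {θ : ℝ} (hθ : θ < 1 / 2) :
    ∫⁻ x, ENNReal.ofReal (Real.exp (θ * x ^ 2)) ∂(gaussianReal 0 1) =
      ENNReal.ofReal (1 / √(1 - 2 * θ)) := by
  rw [lintegral_gaussianReal _ (by fun_prop)]
  have h : ∀ x : ℝ, ENNReal.ofReal ((√(2 * Real.pi))⁻¹ * Real.exp (-(1 / 2) * x ^ 2)) *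
      ENNReal.ofReal (Real.exp (θ * x ^ 2)) =
      ENNReal.ofReal ((√(2 * Real.pi))⁻¹ * Real.exp (-(1 / 2 - θ) * x ^ 2)) := by
    intro x
    rw [← ENNReal.ofReal_mul (by positivity), mul_assoc, ← Real.exp_add]
    ring_nf
  simp_rw [h]
  rw [← ofReal_integral_eq_lintegral_ofReal
    ((integrable_exp_neg_mul_sq (by linarith)).const_mul _)
    (Filter.Eventually.of_forall fun x => by positivity), integral_const_mul, integral_gaussian]
  congr 1
  rw [one_div (√_), ← Real.sqrt_inv, ← Real.sqrt_inv, ← Real.sqrt_mul (by positivity)]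
  congr 1
  have := Real.pi_pos
  have : 1 / 2 - θ ≠ 0 := by linarith
  have : 1 - 2 * θ ≠ 0 := by linarith
  field_simp

lemma tendsto_pow_mul_exp_neg_sq_cocompact (n : ℕ) :
    Filter.Tendsto (fun x : ℝ => x ^ n * Real.exp (-(1 / 2) * x ^ 2)) (Filter.cocompact ℝ)
      (nhds 0) := by
  rw [tendsto_zero_iff_abs_tendsto_zero]
  refine (tendsto_rpow_abs_mul_exp_neg_mul_sq_cocompact (a := 1 / 2) (by norm_num) n).congr
    fun x => ?_
  simp [abs_mul, abs_pow]

lemma integrable_pow_mul_exp_neg_sq (n : ℕ) :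
    Integrable (fun x : ℝ => x ^ n * Real.exp (-(1 / 2) * x ^ 2)) := by
  simpa using integrable_rpow_mul_exp_neg_mul_sq (b := 1 / 2) (by norm_num) (s := n)
    (by linarith [Nat.cast_nonneg (α := ℝ) n])

lemma hasDerivAt_mul_exp_neg_sq {p : ℝ → ℝ} {p' x : ℝ} (hp : HasDerivAt p p' x) :
    HasDerivAt (fun x => p x * Real.exp (-(1 / 2) * x ^ 2))
      ((p' - x * p x) * Real.exp (-(1 / 2) * x ^ 2)) x := by
  refine (hp.mul (((hasDerivAt_pow 2 x).const_mul (-(1 / 2))).exp)).congr_deriv ?_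
  push_cast; ring

lemma integral_exp_neg_half_sq : ∫ x : ℝ, Real.exp (-(1 / 2) * x ^ 2) = √(2 * Real.pi) := by
  rw [integral_gaussian]; congr 1; ring

lemma lintegral_pow_four_gaussianReal :
    ∫⁻ x, ENNReal.ofReal (x ^ 4) ∂(gaussianReal 0 1) = ENNReal.ofReal 3 := by
  rw [lintegral_gaussianReal _ (by fun_prop)]
  have h : ∀ x : ℝ, ENNReal.ofReal ((√(2 * Real.pi))⁻¹ * Real.exp (-(1 / 2) * x ^ 2)) *
      ENNReal.ofReal (x ^ 4) =
      ENNReal.ofReal ((√(2 * Real.pi))⁻¹ * (x ^ 4 * Real.exp (-(1 / 2) * x ^ 2))) := by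
    intro x
    rw [← ENNReal.ofReal_mul (by positivity)]
    ring_nf
  simp_rw [h]
  rw [← ofReal_integral_eq_lintegral_ofReal ((integrable_pow_mul_exp_neg_sq 4).const_mul _)
    (Filter.Eventually.of_forall fun x => by positivity), integral_const_mul]
  -- This antiderivative vanishes at both infinities, so the integral of `(x ^ 4 - 3) * exp (-x ^ 2
  -- / 2)` is zero.
  have hd : ∀ x : ℝ, HasDerivAt (fun x => -(x ^ 3 + 3 * x) * Real.exp (-(1 / 2) * x ^ 2))
      ((x ^ 4 - 3) * Real.exp (-(1 / 2) * x ^ 2)) x := by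
    intro x
    have h : HasDerivAt (fun x : ℝ => -(x ^ 3 + 3 * x)) (-(3 * x ^ 2 + 3)) x := by
      refine (((hasDerivAt_pow 3 x).add ((hasDerivAt_id x).const_mul 3)).neg).congr_deriv ?_
      push_cast; ring
    exact (hasDerivAt_mul_exp_neg_sq h).congr_deriv (by ring)
  have ht : Filter.Tendsto (fun x : ℝ => -(x ^ 3 + 3 * x) * Real.exp (-(1 / 2) * x ^ 2))
      (Filter.cocompact ℝ) (nhds 0) := by
    have := ((tendsto_pow_mul_exp_neg_sq_cocompact 3).add
      ((tendsto_pow_mul_exp_neg_sq_cocompact 1).const_mul 3)).neg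
    simp only [mul_zero, add_zero, neg_zero] at this
    exact this.congr fun x => by ring
  have hi : Integrable fun x : ℝ => (x ^ 4 - 3) * Real.exp (-(1 / 2) * x ^ 2) := by
    refine ((integrable_pow_mul_exp_neg_sq 4).sub
      ((integrable_pow_mul_exp_neg_sq 0).const_mul 3)).congr
      (Filter.Eventually.of_forall fun x => by simp; ring)
  have hz := integral_of_hasDerivAt_of_tendsto hd hi
    (ht.mono_left (by rw [cocompact_eq_atBot_atTop]; exact le_sup_left))
    (ht.mono_left (by rw [cocompact_eq_atBot_atTop]; exact le_sup_right))
  have h4 : ∫ x : ℝ, x ^ 4 * Real.exp (-(1 / 2) * x ^ 2) = 3 * √(2 * Real.pi) := by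
    have e : ∀ x : ℝ, (x ^ 4 - 3) * Real.exp (-(1 / 2) * x ^ 2) =
      x ^ 4 * Real.exp (-(1 / 2) * x ^ 2) - 3 * Real.exp (-(1 / 2) * x ^ 2) := fun x => by ring
    simp_rw [e] at hz
    rw [integral_sub (integrable_pow_mul_exp_neg_sq 4)
      ((integrable_exp_neg_mul_sq (by norm_num)).const_mul _), integral_const_mul,
      integral_exp_neg_half_sq] at hz
    linarith
  rw [h4]
  congr 1
  have : √(2 * Real.pi) ≠ 0 := by positivity
  field_simp

lemma lintegral_sq_gaussianReal :
    ∫⁻ x, ENNReal.ofReal (x ^ 2) ∂(gaussianReal 0 1) = 1 := by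
  have hm : MemLp (fun x : ℝ => x) 2 (gaussianReal 0 1) := memLp_id_gaussianReal 2
  rw [← ofReal_integral_eq_lintegral_ofReal hm.integrable_sq
    (Filter.Eventually.of_forall fun x => sq_nonneg x)]
  have := variance_fun_id_gaussianReal (μ := 0) (v := 1)
  rw [variance_of_integral_eq_zero (by fun_prop) (by simp [integral_id_gaussianReal])] at this
  simp [this]

lemma inv_sqrt_two_pi_le : (√(2 * Real.pi))⁻¹ ≤ 0.39895 := by
  rw [inv_le_comm₀ (by positivity) (by norm_num)]
  refine Real.le_sqrt_of_sq_le ?_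
  have := Real.pi_gt_d6
  norm_num at this ⊢
  linarith

/-- Since `ENNReal.ofReal` takes the positive part, only `|x| > 1` counts. There `-x * exp (-x ^ 2 /
2)` is an antiderivative, and the value is twice the Gaussian density at `1`. -/
lemma lintegral_sq_sub_one_gaussianReal_le :
    ∫⁻ x, ENNReal.ofReal (x ^ 2 - 1) ∂(gaussianReal 0 1) ≤ ENNReal.ofReal 0.484 := by
  set F : ℝ → ℝ≥0∞ := (Set.Ioi 1).indicator fun x => ENNReal.ofReal (x ^ 2 - 1)
  have hF : Measurable F := Measurable.indicator (by fun_prop) measurableSet_Ioi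
  have hneg : ∫⁻ x, F (-x) ∂(gaussianReal 0 1) = ∫⁻ x, F x ∂(gaussianReal 0 1) := by
    have := lintegral_map (μ := gaussianReal 0 1) hF measurable_neg
    rw [show Neg.neg = fun x : ℝ => -x from rfl, gaussianReal_map_neg, neg_zero] at this
    exact this.symm
  have hle : ∀ x : ℝ, ENNReal.ofReal (x ^ 2 - 1) ≤ F x + F (-x) := by
    intro x
    by_cases h1 : 1 < x
    · refine le_add_right (le_of_eq ?_)
      simp [F, Set.indicator_of_mem (Set.mem_Ioi.2 h1)]
    by_cases h2 : 1 < -x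
    · refine le_add_left (le_of_eq ?_)
      simp only [F, Set.indicator_of_mem (Set.mem_Ioi.2 h2), neg_sq]
    · rw [ENNReal.ofReal_of_nonpos (by nlinarith)]
      exact zero_le
  have hone : ∫⁻ x, F x ∂(gaussianReal 0 1) ≤ ENNReal.ofReal 0.242 := by
    rw [lintegral_gaussianReal _ hF]
    have e : ∀ x : ℝ, ENNReal.ofReal ((√(2 * Real.pi))⁻¹ * Real.exp (-(1 / 2) * x ^ 2)) * F x =
        (Set.Ioi 1).indicator (fun x => ENNReal.ofReal ((√(2 * Real.pi))⁻¹ *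
          ((x ^ 2 - 1) * Real.exp (-(1 / 2) * x ^ 2)))) x := by
      intro x
      by_cases h : x ∈ Set.Ioi (1 : ℝ)
      · simp only [F, Set.indicator_of_mem h]
        rw [← ENNReal.ofReal_mul (by positivity)]; ring_nf
      · simp [F, Set.indicator_of_notMem h]
    simp_rw [e]
    rw [lintegral_indicator measurableSet_Ioi]
    have hd : ∀ x ∈ Set.Ici (1 : ℝ), HasDerivAt (fun x => -x * Real.exp (-(1 / 2) * x ^ 2))
        ((x ^ 2 - 1) * Real.exp (-(1 / 2) * x ^ 2)) x := by
      intro x _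
      have h : HasDerivAt (fun x : ℝ => -x) (-1) x := (hasDerivAt_id x).neg
      exact (hasDerivAt_mul_exp_neg_sq h).congr_deriv (by ring)
    have ht : Filter.Tendsto (fun x : ℝ => -x * Real.exp (-(1 / 2) * x ^ 2))
        Filter.atTop (nhds 0) := by
      have := (tendsto_pow_mul_exp_neg_sq_cocompact 1).neg
      rw [neg_zero] at this
      exact (this.congr fun x => by ring).mono_left
        (by rw [cocompact_eq_atBot_atTop]; exact le_sup_right)
    have hnn : ∀ x ∈ Set.Ioi (1 : ℝ), 0 ≤ (x ^ 2 - 1) * Real.exp (-(1 / 2) * x ^ 2) := by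
      intro x hx
      have : (1 : ℝ) < x := hx
      exact mul_nonneg (by nlinarith) (Real.exp_pos _).le
    rw [← ofReal_integral_eq_lintegral_ofReal
      ((integrableOn_Ioi_deriv_of_nonneg' hd hnn ht).const_mul _)
      ((ae_restrict_iff' measurableSet_Ioi).2 (Filter.Eventually.of_forall fun x hx =>
        mul_nonneg (by positivity) (hnn x hx))), integral_const_mul,
      integral_Ioi_of_hasDerivAt_of_nonneg' hd hnn ht]
    refine ENNReal.ofReal_le_ofReal ?_
    have h1 : Real.exp (-(1 / 2) * 1 ^ 2) ≤ 0.60654 := by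
      have h2 : Real.exp (-(1 / 2) * 1 ^ 2) ^ 2 = Real.exp (-1) := by
        rw [← Real.exp_nat_mul]; norm_num
      have := Real.exp_neg_one_lt_d9
      refine le_of_sq_le_sq ?_ (by norm_num)
      rw [h2]; norm_num at this ⊢; linarith
    have h3 := inv_sqrt_two_pi_le
    have h4 : (√(2 * Real.pi))⁻¹ * Real.exp (-(1 / 2) * 1 ^ 2) ≤ 0.39895 * 0.60654 := by gcongr
    norm_num at h4 ⊢; linarith
  calc _ ≤ ∫⁻ x, (F x + F (-x)) ∂(gaussianReal 0 1) := lintegral_mono hle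
    _ = ∫⁻ x, F x ∂(gaussianReal 0 1) + ∫⁻ x, F x ∂(gaussianReal 0 1) := by
      rw [lintegral_add_left hF, hneg]
    _ ≤ ENNReal.ofReal 0.242 + ENNReal.ofReal 0.242 := by gcongr
    _ = _ := by rw [← ENNReal.ofReal_add (by norm_num) (by norm_num)]; norm_num

/-! ### Small-ball and tail bounds for one complex Gaussian form. -/

lemma gaussianReal_le_volume {v : ℝ} (hv : 0 < v) :
    gaussianReal 0 v.toNNReal ≤ ENNReal.ofReal ((√(2 * Real.pi * v))⁻¹) • volume := by
  have hv' : v.toNNReal ≠ 0 := by simpa using hv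
  rw [gaussianReal_of_var_ne_zero _ hv', ← withDensity_const]
  refine withDensity_mono (Filter.Eventually.of_forall fun x => ?_)
  refine ENNReal.ofReal_le_ofReal ?_
  rw [gaussianPDFReal, Real.coe_toNNReal _ hv.le]
  refine mul_le_of_le_one_right (by positivity) (Real.exp_le_one_iff.2 ?_)
  exact div_nonpos_of_nonpos_of_nonneg (by nlinarith [sq_nonneg (x - 0)]) (by positivity)

/-- Half the opposite phase of `∑ i, v i ^ 2` makes that sum real and nonnegative. Its imaginary
part is twice the covariance of the real and imaginary forms, its real part the difference of their
variances. The rotation thus makes the two forms independent without changing the modulus. -/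
lemma exists_unit_mul_sum_sq {ι : Type*} [Fintype ι] (v : ι → ℂ) :
    ∃ w : ℂ, ‖w‖ = 1 ∧ ∑ i, (w * v i).re * (w * v i).im = 0 ∧
      ∑ i, (w * v i).im ^ 2 ≤ ∑ i, (w * v i).re ^ 2 := by
  set S := ∑ i, v i ^ 2
  set w := Complex.exp ((-(S.arg / 2) : ℝ) * Complex.I)
  have hw : ∑ i, (w * v i) ^ 2 = (‖S‖ : ℂ) := by
    simp_rw [mul_pow]
    rw [← Finset.mul_sum, ← Complex.exp_nat_mul]
    have : S = ‖S‖ * Complex.exp (S.arg * Complex.I) := (Complex.norm_mul_exp_arg_mul_I S).symm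
    refine (congrArg (Complex.exp _ * ·) this).trans ?_
    rw [mul_left_comm, ← Complex.exp_add]
    have : ((2 : ℕ) : ℂ) * (((-(S.arg / 2) : ℝ) : ℂ) * Complex.I) + S.arg * Complex.I = 0 := by
      push_cast; ring
    rw [this, Complex.exp_zero, mul_one]
  refine ⟨w, Complex.norm_exp_ofReal_mul_I _, ?_, ?_⟩
  · have := congrArg Complex.im hw
    simp only [Complex.im_sum, Complex.ofReal_im, sq, Complex.mul_im (w * v _)] at this
    have h2 : ∑ i, (w * v i).re * (w * v i).im * 2 = 0 := by
      rw [← this]; exact Finset.sum_congr rfl fun i _ => by ring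
    rw [← Finset.sum_mul] at h2
    linarith
  · have := congrArg Complex.re hw
    simp only [Complex.re_sum, Complex.ofReal_re, sq, Complex.mul_re (w * v _)] at this
    rw [Finset.sum_sub_distrib] at this
    simp only [sq]
    linarith [norm_nonneg S]

lemma volume_disc (t : ℝ) (ht : 0 ≤ t) :
    volume {p : ℝ × ℝ | p.1 ^ 2 + p.2 ^ 2 < t ^ 2} = ENNReal.ofReal (Real.pi * t ^ 2) := by
  have h := Complex.volume_preserving_equiv_real_prod.measure_preimage
    (s := {p : ℝ × ℝ | p.1 ^ 2 + p.2 ^ 2 < t ^ 2})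
    (measurableSet_lt (by fun_prop) (by fun_prop)).nullMeasurableSet
  rw [← h]
  have : Complex.measurableEquivRealProd ⁻¹' {p : ℝ × ℝ | p.1 ^ 2 + p.2 ^ 2 < t ^ 2} =
      Metric.ball 0 t := by
    ext z
    simp only [Set.mem_preimage, Set.mem_ofPred_eq, Complex.measurableEquivRealProd_apply,
      mem_ball_zero_iff]
    rw [← pow_lt_pow_iff_left₀ (norm_nonneg z) ht two_ne_zero, Complex.sq_norm,
      Complex.normSq_apply, sq, sq]
  rw [this, Complex.volume_ball]
  rw [mul_comm Real.pi, ENNReal.ofReal_mul (by positivity), ENNReal.ofReal_pow ht]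
  congr 1
  rw [← NNReal.coe_real_pi, ENNReal.ofReal_coe_nnreal]

section
variable {ι : Type*} [Fintype ι]

lemma stdGaussianPi_abs_linear_lt_le (a : ι → ℝ) (ha : 0 < ∑ i, a i ^ 2) (t : ℝ) :
    stdGaussianPi ι {g | |∑ i, g i * a i| < t} ≤
      ENNReal.ofReal (2 * t * (√(2 * Real.pi))⁻¹ / √(∑ i, a i ^ 2)) := by
  have hm : MeasurableSet {x : ℝ | |x| < t} := measurableSet_lt (by fun_prop) (by fun_prop)
  have := Measure.map_apply (μ := stdGaussianPi ι) (f := fun g => ∑ i, g i * a i)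
    (by fun_prop) hm
  rw [map_linear_stdGaussianPi] at this
  change _ ≤ _
  refine (this.symm.le : stdGaussianPi ι {g | |∑ i, g i * a i| < t} ≤ _).trans
    ((gaussianReal_le_volume ha _).trans ?_)
  have hb : {x : ℝ | |x| < t} = Metric.ball 0 t := by ext; simp
  rw [Measure.smul_apply, hb, Real.volume_ball, smul_eq_mul,
    ← ENNReal.ofReal_mul (by positivity)]
  refine ENNReal.ofReal_le_ofReal (le_of_eq ?_)
  rw [Real.sqrt_mul (by positivity), mul_inv]
  ring

lemma stdGaussianPi_sq_add_sq_lt_le (a b : ι → ℝ) (hab : ∑ i, a i * b i = 0)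
    (ha : 0 < ∑ i, a i ^ 2) (hb : 0 < ∑ i, b i ^ 2) (t : ℝ) (ht : 0 ≤ t) :
    stdGaussianPi ι {g | (∑ i, g i * a i) ^ 2 + (∑ i, g i * b i) ^ 2 < t ^ 2} ≤
      ENNReal.ofReal (t ^ 2 / (2 * √((∑ i, a i ^ 2) * ∑ i, b i ^ 2))) := by
  have hm : MeasurableSet {p : ℝ × ℝ | p.1 ^ 2 + p.2 ^ 2 < t ^ 2} :=
    measurableSet_lt (by fun_prop) (by fun_prop)
  have := Measure.map_apply (μ := stdGaussianPi ι)
    (f := fun g => (∑ i, g i * a i, ∑ i, g i * b i)) (by fun_prop) hm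
  rw [map_linear_pair_stdGaussianPi a b hab] at this
  refine (this.symm.le : stdGaussianPi ι
    {g | (∑ i, g i * a i) ^ 2 + (∑ i, g i * b i) ^ 2 < t ^ 2} ≤ _).trans
    ((Measure.prod_mono (gaussianReal_le_volume ha) (gaussianReal_le_volume hb) _).trans ?_)
  rw [Measure.prod_smul_left, Measure.prod_smul_right, Measure.smul_apply, Measure.smul_apply,
    ← Measure.volume_eq_prod, volume_disc t ht, smul_eq_mul, smul_eq_mul,
    ← ENNReal.ofReal_mul (by positivity), ← ENNReal.ofReal_mul (by positivity)]
  refine ENNReal.ofReal_le_ofReal (le_of_eq ?_)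
  rw [Real.sqrt_mul (by positivity), Real.sqrt_mul (x := 2 * Real.pi) (by positivity),
    Real.sqrt_mul ha.le]
  have h1 : √(2 * Real.pi) ^ 2 = 2 * Real.pi := Real.sq_sqrt (by positivity)
  have h2 : √(2 * Real.pi) ≠ 0 := by positivity
  have h3 : √(∑ i, a i ^ 2) ≠ 0 := by positivity
  have h4 : √(∑ i, b i ^ 2) ≠ 0 := by positivity
  field_simp
  rw [h1]

lemma lintegral_convex_sq_add_sq_le (a b : ι → ℝ) (f : ℝ → ℝ)
    (hf : ConvexOn ℝ Set.univ f) (hfc : Continuous f) :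
    ∫⁻ g, ENNReal.ofReal (f ((∑ i, g i * a i) ^ 2 + (∑ i, g i * b i) ^ 2)) ∂(stdGaussianPi ι) ≤
      ∫⁻ x, ENNReal.ofReal (f ((∑ i, a i ^ 2 + ∑ i, b i ^ 2) * x ^ 2)) ∂(gaussianReal 0 1) := by
  simpa using lintegral_convex_quadratic_le (κ := Bool) (fun k => if k then a else b) f hf hfc

/-- Markov for the square of the quadratic form, whose mean is at most that of the rank-one form,
`3` times the squared trace. -/
lemma stdGaussianPi_le_sq_add_sq_le_of_fourth_moment (a b : ι → ℝ) (u : ℝ) (hu : 0 < u) :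
    stdGaussianPi ι {g | u ≤ (∑ i, g i * a i) ^ 2 + (∑ i, g i * b i) ^ 2} ≤
      ENNReal.ofReal (3 * (∑ i, a i ^ 2 + ∑ i, b i ^ 2) ^ 2 / u ^ 2) := by
  set s := ∑ i, a i ^ 2 + ∑ i, b i ^ 2
  have h := lintegral_convex_sq_add_sq_le a b (fun z => z ^ 2) (Even.convexOn_pow even_two)
    (by fun_prop)
  have e : ∀ x : ℝ, ENNReal.ofReal (((∑ i, a i ^ 2 + ∑ i, b i ^ 2) * x ^ 2) ^ 2) =
      ENNReal.ofReal (s ^ 2) * ENNReal.ofReal (x ^ 4) := by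
    intro x
    rw [← ENNReal.ofReal_mul (by positivity)]; congr 1; ring
  simp_rw [e] at h
  rw [lintegral_const_mul _ (by fun_prop), lintegral_pow_four_gaussianReal,
    ← ENNReal.ofReal_mul (by positivity)] at h
  have hM := meas_ge_le_lintegral_div (μ := stdGaussianPi ι)
    (f := fun g => ENNReal.ofReal (((∑ i, g i * a i) ^ 2 + (∑ i, g i * b i) ^ 2) ^ 2))
    (by fun_prop) (ε := ENNReal.ofReal (u ^ 2)) (by simpa using hu.ne') ENNReal.ofReal_ne_top
  refine (measure_mono fun g hg => ?_).trans (hM.trans ((ENNReal.div_le_div_right h _).trans ?_))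
  · simp only [Set.mem_ofPred_eq] at hg ⊢
    exact ENNReal.ofReal_le_ofReal (by gcongr)
  · rw [← ENNReal.ofReal_div_of_pos (by positivity), mul_comm]

/-- Markov for the positive part of `z / s - 1`, with `s` the trace. It is sharper than the fourth
moment when `s` is not small compared with `u`. -/
lemma stdGaussianPi_le_sq_add_sq_le (a b : ι → ℝ) (u : ℝ)
    (hs : 0 < ∑ i, a i ^ 2 + ∑ i, b i ^ 2) (hu : ∑ i, a i ^ 2 + ∑ i, b i ^ 2 < u) :
    stdGaussianPi ι {g | u ≤ (∑ i, g i * a i) ^ 2 + (∑ i, g i * b i) ^ 2} ≤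
      ENNReal.ofReal (0.484 * (∑ i, a i ^ 2 + ∑ i, b i ^ 2) /
        (u - (∑ i, a i ^ 2 + ∑ i, b i ^ 2))) := by
  set s := ∑ i, a i ^ 2 + ∑ i, b i ^ 2
  have hc : ConvexOn ℝ Set.univ fun z : ℝ => s⁻¹ * z - 1 :=
    (((LinearMap.mul ℝ ℝ s⁻¹).convexOn convex_univ)).sub (concaveOn_const 1 convex_univ)
  have h := lintegral_convex_sq_add_sq_le a b (fun z => s⁻¹ * z - 1) hc (by fun_prop)
  have e : ∀ x : ℝ, s⁻¹ * (s * x ^ 2) - 1 = x ^ 2 - 1 := by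
    intro x; field_simp
  simp_rw [← show s = ∑ i, a i ^ 2 + ∑ i, b i ^ 2 from rfl, e] at h
  have h := h.trans lintegral_sq_sub_one_gaussianReal_le
  have hpos : 0 < s⁻¹ * u - 1 := by
    rw [sub_pos, inv_mul_eq_div, one_lt_div hs]; exact hu
  have hM := meas_ge_le_lintegral_div (μ := stdGaussianPi ι)
    (f := fun g => ENNReal.ofReal (s⁻¹ * ((∑ i, g i * a i) ^ 2 + (∑ i, g i * b i) ^ 2) - 1))
    (by fun_prop) (ε := ENNReal.ofReal (s⁻¹ * u - 1)) (by simpa using hpos)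
    ENNReal.ofReal_ne_top
  refine (measure_mono fun g hg => ?_).trans (hM.trans ((ENNReal.div_le_div_right h _).trans ?_))
  · simp only [Set.mem_ofPred_eq] at hg ⊢
    exact ENNReal.ofReal_le_ofReal (by gcongr)
  · rw [← ENNReal.ofReal_div_of_pos hpos]
    refine ENNReal.ofReal_le_ofReal (le_of_eq ?_)
    have : u - s ≠ 0 := by linarith
    have : s⁻¹ * u - 1 = (u - s) / s := by field_simp
    rw [this]; field_simp

/-- If the real part carries `8/9` of the variance, its one-dimensional density suffices. Otherwise
both variances are bounded below, and the area of the disc times the peak of the planar density is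
good enough; this is where `σ ≥ 3/4` is needed. -/
lemma stdGaussianPi_sq_add_sq_lt_le_sqrt (a b : ι → ℝ) (hab : ∑ i, a i * b i = 0)
    (hle : ∑ i, b i ^ 2 ≤ ∑ i, a i ^ 2) {σ : ℝ} (hσ : 3 / 4 ≤ σ)
    (hs : ∑ i, a i ^ 2 + ∑ i, b i ^ 2 = σ ^ 2) :
    stdGaussianPi ι {g | (∑ i, g i * a i) ^ 2 + (∑ i, g i * b i) ^ 2 < 0.4 ^ 2} ≤
      ENNReal.ofReal (0.3395 / σ) := by
  have hσ0 : 0 < σ := by linarith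
  have ha : 0 < ∑ i, a i ^ 2 := by nlinarith
  by_cases h : 8 / 9 * σ ^ 2 ≤ ∑ i, a i ^ 2
  · refine (measure_mono fun g hg => ?_).trans ((stdGaussianPi_abs_linear_lt_le a ha 0.4).trans
      (ENNReal.ofReal_le_ofReal ?_))
    · simp only [Set.mem_ofPred_eq] at hg ⊢
      refine abs_lt_of_sq_lt_sq ?_ (by norm_num)
      nlinarith [sq_nonneg (∑ i, g i * b i)]
    · have h1 : 0.9428 * σ ≤ √(∑ i, a i ^ 2) := by
        refine Real.le_sqrt_of_sq_le ?_
        nlinarith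
      have h2 := inv_sqrt_two_pi_le
      calc 2 * 0.4 * (√(2 * Real.pi))⁻¹ / √(∑ i, a i ^ 2)
          ≤ 2 * 0.4 * 0.39895 / (0.9428 * σ) := by gcongr
        _ ≤ _ := by
          rw [div_le_div_iff₀ (by positivity) hσ0]; nlinarith
  · push Not at h
    have hb : 0 < ∑ i, b i ^ 2 := by nlinarith
    refine (stdGaussianPi_sq_add_sq_lt_le a b hab ha hb 0.4 (by norm_num)).trans
      (ENNReal.ofReal_le_ofReal ?_)
    have h1 : 0.31426 * σ ^ 2 ≤ √((∑ i, a i ^ 2) * ∑ i, b i ^ 2) := by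
      refine Real.le_sqrt_of_sq_le ?_
      have hb' : ∑ i, b i ^ 2 = σ ^ 2 - ∑ i, a i ^ 2 := by linarith
      rw [hb'] at hle ⊢
      nlinarith [mul_nonneg (sub_nonneg.2 h.le) (by linarith : 0 ≤ (∑ i, a i ^ 2) - 1 / 9 * σ ^ 2)]
    calc (0.4 : ℝ) ^ 2 / (2 * √((∑ i, a i ^ 2) * ∑ i, b i ^ 2))
        ≤ 0.4 ^ 2 / (2 * (0.31426 * σ ^ 2)) := by gcongr
      _ ≤ _ := by
        rw [div_le_div_iff₀ (by positivity) hσ0]; nlinarith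

lemma two_sided_bound_of_le_one {σ : ℝ} (h0 : 3 / 4 ≤ σ) (h1 : σ ≤ 1) :
    0.3395 / σ + 3 * (σ ^ 2) ^ 2 / (2.24 ^ 2) ^ 2 ≤ 0.495 := by
  have hσ : 0 < σ := by linarith
  have h5 : σ ^ 5 ≤ 0.2374 + (σ - 3 / 4) * 3.051 := by
    have : σ ^ 3 ≤ 0.421875 + (σ - 3 / 4) * 2.3125 := by nlinarith [mul_nonneg (sub_nonneg.2 h0) (sub_nonneg.2 h1)]
    have h2 : σ ^ 2 ≤ 0.5625 + (σ - 3 / 4) * 1.75 := by nlinarith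
    have : σ ^ 5 = σ ^ 3 * σ ^ 2 := by ring
    nlinarith [mul_nonneg (sub_nonneg.2 h0) (sub_nonneg.2 h1), pow_pos hσ 2, pow_pos hσ 3,
      mul_nonneg (mul_nonneg (sub_nonneg.2 h0) (sub_nonneg.2 h1)) hσ.le]
  have : 0.3395 + σ * (3 * (σ ^ 2) ^ 2 / (2.24 ^ 2) ^ 2) ≤ 0.495 * σ := by
    have e : σ * (3 * (σ ^ 2) ^ 2 / (2.24 ^ 2) ^ 2) = σ ^ 5 * (3 / (2.24 ^ 2) ^ 2) := by ring
    rw [e]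
    have : (3 / (2.24 ^ 2) ^ 2 : ℝ) ≤ 0.1192 := by norm_num
    nlinarith [pow_pos hσ 5]
  have e : 0.3395 / σ + 3 * (σ ^ 2) ^ 2 / (2.24 ^ 2) ^ 2 =
    (0.3395 + σ * (3 * (σ ^ 2) ^ 2 / (2.24 ^ 2) ^ 2)) / σ := by field_simp
  rw [e, div_le_iff₀ hσ]; exact this

lemma two_sided_bound_of_one_le {σ : ℝ} (h0 : 1 ≤ σ) (h1 : σ ≤ 1.2) :
    0.3395 / σ + 0.484 * σ ^ 2 / (2.24 ^ 2 - σ ^ 2) ≤ 0.495 := by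
  have hσ : 0 < σ := by linarith
  have hd : 0 < 2.24 ^ 2 - σ ^ 2 := by nlinarith
  rw [div_add_div _ _ hσ.ne' hd.ne', div_le_iff₀ (by positivity)]
  nlinarith [mul_nonneg (mul_nonneg (sub_nonneg.2 h0) (sub_nonneg.2 h1)) hσ.le,
    mul_nonneg (sub_nonneg.2 h0) (sub_nonneg.2 h1)]

lemma stdGaussianPi_norm_linear_notMem_le_one (v : ι → ℂ)
    (h1 : 9 / 16 ≤ ∑ i, ‖v i‖ ^ 2) (h2 : ∑ i, ‖v i‖ ^ 2 ≤ 23 / 16) :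
    stdGaussianPi ι {g | ¬(0.4 ≤ ‖∑ i, (g i : ℂ) * v i‖ ∧ ‖∑ i, (g i : ℂ) * v i‖ ≤ 2.24)} ≤
      ENNReal.ofReal 0.495 := by
  obtain ⟨w, hw, hab, hle⟩ := exists_unit_mul_sum_sq v
  set a : ι → ℝ := fun i => (w * v i).re
  set b : ι → ℝ := fun i => (w * v i).im
  have hs : ∑ i, a i ^ 2 + ∑ i, b i ^ 2 = ∑ i, ‖v i‖ ^ 2 := by
    rw [← Finset.sum_add_distrib]
    refine Finset.sum_congr rfl fun i _ => ?_
    rw [← one_mul ‖v i‖, ← hw, ← norm_mul, Complex.sq_norm, Complex.normSq_apply]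
    ring
  have hn : ∀ g : ι → ℝ, ‖∑ i, (g i : ℂ) * v i‖ ^ 2 =
      (∑ i, g i * a i) ^ 2 + (∑ i, g i * b i) ^ 2 := by
    intro g
    rw [← one_mul ‖∑ i, (g i : ℂ) * v i‖, ← hw, ← norm_mul, Complex.sq_norm,
      Complex.normSq_apply, Finset.mul_sum, Complex.re_sum, Complex.im_sum]
    simp only [mul_left_comm w, Complex.re_ofReal_mul, Complex.im_ofReal_mul]
    simp only [a, b]; ring
  set σ := √(∑ i, ‖v i‖ ^ 2)
  have hσ2 : σ ^ 2 = ∑ i, ‖v i‖ ^ 2 := Real.sq_sqrt (by linarith)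
  have hσ : 3 / 4 ≤ σ := Real.le_sqrt_of_sq_le (by norm_num at h1 ⊢; linarith)
  have hσ' : σ ≤ 1.2 := Real.sqrt_le_iff.2 ⟨by norm_num, by norm_num at h2 ⊢; linarith⟩
  have hlow := stdGaussianPi_sq_add_sq_lt_le_sqrt a b hab hle hσ (hs.trans hσ2.symm)
  have hsub : {g : ι → ℝ | ¬(0.4 ≤ ‖∑ i, (g i : ℂ) * v i‖ ∧ ‖∑ i, (g i : ℂ) * v i‖ ≤ 2.24)} ⊆
      {g | (∑ i, g i * a i) ^ 2 + (∑ i, g i * b i) ^ 2 < 0.4 ^ 2} ∪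
      {g | 2.24 ^ 2 ≤ (∑ i, g i * a i) ^ 2 + (∑ i, g i * b i) ^ 2} := by
    intro g hg
    simp only [Set.mem_ofPred_eq, Set.mem_union, not_and_or, not_le, ← hn] at hg ⊢
    rcases hg with hg | hg
    · left; gcongr
    · right; gcongr
  refine (measure_mono hsub).trans ((measure_union_le _ _).trans ?_)
  have hs' := hs.trans hσ2.symm
  -- The fourth moment wins for small `σ` but would push the total above `1/2` near `σ = 1.2`; there
  -- the truncated first moment is used.
  rcases le_total σ 1 with hc | hc
  · have hup := stdGaussianPi_le_sq_add_sq_le_of_fourth_moment a b (2.24 ^ 2) (by norm_num)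
    rw [hs'] at hup
    refine (add_le_add hlow hup).trans ?_
    rw [← ENNReal.ofReal_add (by positivity) (by positivity)]
    exact ENNReal.ofReal_le_ofReal (two_sided_bound_of_le_one hσ hc)
  · have hup := stdGaussianPi_le_sq_add_sq_le a b (2.24 ^ 2) (by rw [hs']; positivity)
      (by rw [hs']; nlinarith)
    rw [hs'] at hup
    refine (add_le_add hlow hup).trans ?_
    rw [← ENNReal.ofReal_add (by positivity) (div_nonneg (by positivity) (by nlinarith))]
    exact ENNReal.ofReal_le_ofReal (two_sided_bound_of_one_le hc hσ')

/-- A complex linear form in Gaussian variables, whose variance is between `9/16` and `23/16` of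
`c²`, has modulus between `0.4 c` and `2.24 c` with probability noticeably above one half. -/
lemma stdGaussianPi_norm_linear_notMem_le (v : ι → ℂ) {c : ℝ} (hc : 0 < c)
    (h1 : 9 / 16 * c ^ 2 ≤ ∑ i, ‖v i‖ ^ 2) (h2 : ∑ i, ‖v i‖ ^ 2 ≤ 23 / 16 * c ^ 2) :
    stdGaussianPi ι {g | ¬(0.4 * c ≤ ‖∑ i, (g i : ℂ) * v i‖ ∧
      ‖∑ i, (g i : ℂ) * v i‖ ≤ 2.24 * c)} ≤ ENNReal.ofReal 0.495 := by
  have hs : ∑ i, ‖(c : ℂ)⁻¹ * v i‖ ^ 2 = (∑ i, ‖v i‖ ^ 2) / c ^ 2 := by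
    rw [Finset.sum_div]
    refine Finset.sum_congr rfl fun i _ => ?_
    rw [norm_mul, norm_inv, Complex.norm_of_nonneg hc.le]
    field_simp
  have h := stdGaussianPi_norm_linear_notMem_le_one (fun i => (c : ℂ)⁻¹ * v i)
    (by rw [hs, le_div_iff₀ (by positivity)]; exact h1)
    (by rw [hs, div_le_iff₀ (by positivity)]; exact h2)
  refine (measure_mono fun g hg => ?_).trans h
  have e : ‖∑ i, (g i : ℂ) * ((c : ℂ)⁻¹ * v i)‖ = ‖∑ i, (g i : ℂ) * v i‖ / c := by
    simp_rw [mul_left_comm _ (c : ℂ)⁻¹]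
    rw [← Finset.mul_sum, norm_mul, norm_inv, Complex.norm_of_nonneg hc.le]
    field_simp
  simp only [Set.mem_ofPred_eq] at hg ⊢
  rwa [e, le_div_iff₀ hc, div_le_iff₀ hc]
end

/-! ### Exponential moments of the energy; concentration of the norm of the weights. -/

section
variable {ι : Type*} [Fintype ι]

lemma lintegral_convex_complex_quadratic_le {κ : Type*} [Fintype κ] (v : κ → ι → ℂ) (f : ℝ → ℝ)
    (hf : ConvexOn ℝ Set.univ f) (hfc : Continuous f) :
    ∫⁻ g, ENNReal.ofReal (f (∑ k, ‖∑ i, (g i : ℂ) * v k i‖ ^ 2)) ∂(stdGaussianPi ι) ≤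
      ∫⁻ x, ENNReal.ofReal (f ((∑ k, ∑ i, ‖v k i‖ ^ 2) * x ^ 2)) ∂(gaussianReal 0 1) := by
  have h := lintegral_convex_quadratic_le (κ := κ × Bool)
    (fun k i => if k.2 then (v k.1 i).re else (v k.1 i).im) f hf hfc
  simp only [Fintype.sum_prod_type, Fintype.sum_bool, if_true, Bool.false_eq_true, if_false] at h
  have e1 : ∀ (g : ι → ℝ) k, ‖∑ i, (g i : ℂ) * v k i‖ ^ 2 =
      (∑ i, g i * (v k i).re) ^ 2 + (∑ i, g i * (v k i).im) ^ 2 := by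
    intro g k
    rw [Complex.sq_norm, Complex.normSq_apply, Complex.re_sum, Complex.im_sum]
    simp only [Complex.re_ofReal_mul, Complex.im_ofReal_mul]
    ring
  have e2 : ∀ k, ∑ i, ‖v k i‖ ^ 2 = ∑ i, (v k i).re ^ 2 + ∑ i, (v k i).im ^ 2 := by
    intro k
    rw [← Finset.sum_add_distrib]
    refine Finset.sum_congr rfl fun i _ => ?_
    rw [Complex.sq_norm, Complex.normSq_apply]; ring
  simp_rw [e1, e2]
  exact h

lemma lintegral_complex_quadratic_le {κ : Type*} [Fintype κ] (v : κ → ι → ℂ) :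
    ∫⁻ g, ENNReal.ofReal (∑ k, ‖∑ i, (g i : ℂ) * v k i‖ ^ 2) ∂(stdGaussianPi ι) ≤
      ENNReal.ofReal (∑ k, ∑ i, ‖v k i‖ ^ 2) := by
  refine (lintegral_convex_complex_quadratic_le v (fun z => z) (convexOn_id convex_univ)
    continuous_id).trans ?_
  simp_rw [fun x : ℝ => ENNReal.ofReal_mul (q := x ^ 2)
    (show 0 ≤ ∑ k, ∑ i, ‖v k i‖ ^ 2 by positivity)]
  rw [lintegral_const_mul _ (by fun_prop), lintegral_sq_gaussianReal, mul_one]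

/-- Comparison with the rank-one form of trace at most `2` reduces this to the mean of `exp (x ^ 2 /
4)`, which is `√2`. -/
lemma lintegral_exp_complex_quadratic_le {κ : Type*} [Fintype κ] (v : κ → ι → ℂ)
    (hv : ∑ k, ∑ i, ‖v k i‖ ^ 2 ≤ 2) :
    ∫⁻ g, ENNReal.ofReal (Real.exp (1 / 8 * ∑ k, ‖∑ i, (g i : ℂ) * v k i‖ ^ 2))
      ∂(stdGaussianPi ι) ≤ ENNReal.ofReal 2 := by
  have hc : ConvexOn ℝ Set.univ fun z : ℝ => Real.exp (1 / 8 * z) :=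
    convexOn_exp.comp_linearMap (LinearMap.mul ℝ ℝ (1 / 8))
  refine (lintegral_convex_complex_quadratic_le v (fun z => Real.exp (1 / 8 * z)) hc
    (by fun_prop)).trans ?_
  calc _ ≤ ∫⁻ x, ENNReal.ofReal (Real.exp (1 / 4 * x ^ 2)) ∂(gaussianReal 0 1) := by
        refine lintegral_mono fun x => ENNReal.ofReal_le_ofReal (Real.exp_le_exp.2 ?_)
        nlinarith [mul_le_mul_of_nonneg_right hv (sq_nonneg x)]
    _ = ENNReal.ofReal (1 / √(1 - 2 * (1 / 4))) := lintegral_exp_sq_gaussianReal (by norm_num)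
    _ ≤ _ := by
        refine ENNReal.ofReal_le_ofReal ?_
        rw [div_le_iff₀ (by rw [Real.sqrt_pos]; norm_num)]
        have : 1 / 2 ≤ √(1 - 2 * (1 / 4) : ℝ) := Real.le_sqrt_of_sq_le (by norm_num)
        linarith

/-- The level `16` is `8 * 2`, so each copy contributes a factor `exp (-2) * 2 ≤ exp (-1)`. -/
lemma measure_pi_sum_complex_quadratic_ge_le {κ : Type*} [Fintype κ] (v : κ → ι → ℂ)
    (hv : ∑ k, ∑ i, ‖v k i‖ ^ 2 ≤ 2) (L : ℕ) :
    (Measure.pi fun _ : Fin L => stdGaussianPi ι)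
      {g | 16 * L ≤ ∑ l, ∑ k, ‖∑ i, (g l i : ℂ) * v k i‖ ^ 2} ≤
      ENNReal.ofReal (Real.exp (-L)) := by
  have h := measure_pi_sum_ge_le (ι := Fin L) (stdGaussianPi ι)
    (fun g => 1 / 8 * ∑ k, ‖∑ i, (g i : ℂ) * v k i‖ ^ 2) (by fun_prop) 2 zero_le_two
    (lintegral_exp_complex_quadratic_le v hv)
  refine (measure_mono fun g hg => ?_).trans (h.trans (ENNReal.ofReal_le_ofReal ?_))
  · simp only [Set.mem_ofPred_eq, Fintype.card_fin] at hg ⊢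
    rw [← Finset.mul_sum]
    linarith
  · rw [Fintype.card_fin, show -(L : ℝ) = L * (-1) by ring, Real.exp_nat_mul]
    gcongr
    have h2 : Real.exp (-2) = Real.exp (-1) * Real.exp (-1) := by rw [← Real.exp_add]; norm_num
    have h3 := Real.exp_neg_one_lt_d9
    have h4 := Real.exp_pos (-1)
    rw [h2]
    norm_num at h3
    nlinarith

lemma stdGaussianPi_norm_sq_concentration :
    ∃ c > 0, ∀ m : ℕ, stdGaussianPi (Fin m)
      {g | ¬((m : ℝ) / 2 ≤ ∑ i, g i ^ 2 ∧ ∑ i, g i ^ 2 ≤ 3 / 2 * m)} ≤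
        ENNReal.ofReal (2 * Real.exp (-(c * m))) := by
  -- The Chernoff factors per coordinate, with parameter `1/8` for the upper tail at `3/2` and
  -- `-1/2` for the lower tail at `1/2`.
  set A : ℝ := Real.exp (-(3 / 16)) * (1 / √(1 - 2 * (1 / 8)))
  set B : ℝ := Real.exp (-(-(1 / 4))) * (1 / √(1 - 2 * (-(1 / 2))))
  have hA0 : 0 < A := by
    have : 0 < √(1 - 2 * (1 / 8) : ℝ) := Real.sqrt_pos.2 (by norm_num)
    positivity
  have hB0 : 0 < B := by
    have : 0 < √(1 - 2 * (-(1 / 2)) : ℝ) := Real.sqrt_pos.2 (by norm_num)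
    positivity
  have hA : A < 1 := by
    have h1 : A ^ 2 = Real.exp (-(3 / 8)) * (4 / 3) := by
      rw [mul_pow, ← Real.exp_nat_mul, div_pow, Real.sq_sqrt (by norm_num)]
      norm_num
    have h2 : (4 / 3 : ℝ) < Real.exp (3 / 8) := by
      linarith [Real.add_one_le_exp (3 / 8 : ℝ)]
    have h3 : A ^ 2 < 1 := by
      rw [h1, Real.exp_neg, inv_mul_lt_iff₀ (Real.exp_pos _), mul_one]; exact h2
    nlinarith
  have hB : B < 1 := by
    have h1 : B ^ 2 = Real.exp (1 / 2) * (1 / 2) := by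
      rw [mul_pow, ← Real.exp_nat_mul, div_pow, Real.sq_sqrt (by norm_num)]
      norm_num
    have h2 : Real.exp (1 / 2) < 2 := by
      have : Real.exp (1 / 2) ^ 2 = Real.exp 1 := by rw [← Real.exp_nat_mul]; norm_num
      have := Real.exp_one_lt_d9
      nlinarith [Real.exp_pos (1 / 2)]
    nlinarith
  have hmax : 0 < max A B := lt_max_of_lt_left hA0
  refine ⟨-Real.log (max A B), neg_pos.2 (Real.log_neg hmax (max_lt hA hB)), fun m => ?_⟩
  have hexp : Real.exp (-(-Real.log (max A B) * m)) = max A B ^ m := by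
    rw [neg_mul, neg_neg, mul_comm, Real.exp_nat_mul, Real.exp_log hmax]
  have h1 := measure_pi_sum_ge_le (ι := Fin m) (gaussianReal 0 1) (fun x => 1 / 8 * x ^ 2)
    (by fun_prop) (3 / 16) (by positivity) (lintegral_exp_sq_gaussianReal (by norm_num)).le
  have h2 := measure_pi_sum_ge_le (ι := Fin m) (gaussianReal 0 1) (fun x => -(1 / 2) * x ^ 2)
    (by fun_prop) (-(1 / 4)) (by positivity) (lintegral_exp_sq_gaussianReal (by norm_num)).le
  rw [hexp]
  calc _ ≤ stdGaussianPi (Fin m)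
        ({g | 3 / 16 * (Fintype.card (Fin m) : ℝ) ≤ ∑ i, 1 / 8 * g i ^ 2} ∪
          {g | -(1 / 4) * (Fintype.card (Fin m) : ℝ) ≤ ∑ i, -(1 / 2) * g i ^ 2}) := by
        refine measure_mono fun g hg => ?_
        simp only [Set.mem_ofPred_eq, Set.mem_union, not_and_or, not_le, ← Finset.mul_sum,
          Fintype.card_fin] at hg ⊢
        rcases hg with hg | hg
        · right; linarith
        · left; linarith
    _ ≤ ENNReal.ofReal (A ^ m) + ENNReal.ofReal (B ^ m) := by
        refine (measure_union_le _ _).trans (add_le_add ?_ ?_)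
        · simpa only [Fintype.card_fin] using h1
        · simpa only [Fintype.card_fin] using h2
    _ ≤ _ := by
        rw [← ENNReal.ofReal_add (by positivity) (by positivity), two_mul]
        gcongr
        · exact le_max_left _ _
        · exact le_max_right _ _

lemma exists_stdGaussianPi_norm_sq_le {q : ℝ} (hq : 0 < q) :
    ∃ m₀ : ℕ, ∀ m ≥ m₀, stdGaussianPi (Fin m)
      {g | ¬((m : ℝ) / 2 ≤ ∑ i, g i ^ 2 ∧ ∑ i, g i ^ 2 ≤ 3 / 2 * m)} ≤ ENNReal.ofReal q := by
  obtain ⟨c, hc, h⟩ := stdGaussianPi_norm_sq_concentration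
  have ht : Filter.Tendsto (fun m : ℕ => 2 * Real.exp (-(c * m))) Filter.atTop (nhds 0) := by
    have := (Real.tendsto_exp_neg_atTop_nhds_zero.comp
      (tendsto_natCast_atTop_atTop.const_mul_atTop hc)).const_mul 2
    simpa using this
  obtain ⟨m₀, hm⟩ := Filter.eventually_atTop.1 (ht.eventually (gt_mem_nhds hq))
  exact ⟨m₀, fun m hm' => (h m).trans (ENNReal.ofReal_le_ofReal (hm m hm').le)⟩
end

/-! ### Nets of the unit ball by volume comparison. -/

section
variable {E : Type*} [NormedAddCommGroup E] [NormedSpace ℝ E] [FiniteDimensional ℝ E]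

/-- The balls of radius `ε / 2` around the points are disjoint and lie in the ball of radius `1 + ε
/ 2`. -/
lemma card_le_of_separated_of_subset_closedBall {ε : ℝ} (hε : 0 < ε) (t : Finset E)
    (ht : ∀ x ∈ t, ‖x‖ ≤ 1) (hsep : ∀ x ∈ t, ∀ y ∈ t, x ≠ y → ε < ‖x - y‖) :
    (t.card : ℝ) ≤ (1 + 2 / ε) ^ Module.finrank ℝ E := by
  borelize E
  set n := Module.finrank ℝ E
  set μ : Measure E := Measure.addHaar
  have hdisj : (t : Set E).PairwiseDisjoint fun x => Metric.ball x (ε / 2) := by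
    intro x hx y hy hxy
    refine Metric.ball_disjoint_ball ?_
    rw [add_halves, dist_eq_norm]
    exact (hsep x hx y hy hxy).le
  have h1 : μ (⋃ x ∈ t, Metric.ball x (ε / 2)) ≤ μ (Metric.ball 0 (1 + ε / 2)) := by
    refine measure_mono (Set.iUnion₂_subset fun x hx => Metric.ball_subset_ball' ?_)
    rw [dist_zero_right]; linarith [ht x hx]
  rw [measure_biUnion_finset hdisj fun _ _ => measurableSet_ball] at h1
  simp only [Measure.addHaar_ball_of_pos μ _ (show 0 < ε / 2 by positivity),
    Measure.addHaar_ball_of_pos μ _ (show 0 < 1 + ε / 2 by positivity), Finset.sum_const,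
    nsmul_eq_mul] at h1
  rw [← mul_assoc, ENNReal.mul_le_mul_iff_left (Metric.measure_ball_pos μ _ one_pos).ne'
    measure_ball_lt_top.ne, ← ENNReal.ofReal_natCast, ← ENNReal.ofReal_mul (by positivity),
    ENNReal.ofReal_le_ofReal_iff (by positivity)] at h1
  rw [show 1 + 2 / ε = (1 + ε / 2) / (ε / 2) by field_simp; ring, div_pow,
    le_div_iff₀ (by positivity)]
  exact h1

/-- The closed unit ball has an `ε`-net of cardinality at most `(1 + 2 / ε) ^ dim`. -/
lemma exists_net_closedBall {ε : ℝ} (hε : 0 < ε) :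
    ∃ t : Finset E, (t.card : ℝ) ≤ (1 + 2 / ε) ^ Module.finrank ℝ E ∧
      (∀ x ∈ t, ‖x‖ ≤ 1) ∧ ∀ x : E, ‖x‖ ≤ 1 → ∃ y ∈ t, ‖x - y‖ ≤ ε := by
  classical
  -- A separated set of maximal cardinality is a net: a point far from all of it could be added.
  set P : Finset E → Prop := fun t =>
    (∀ x ∈ t, ‖x‖ ≤ 1) ∧ ∀ x ∈ t, ∀ y ∈ t, x ≠ y → ε < ‖x - y‖
  have hbdd : BddAbove (Finset.card '' {t | P t}) := by
    refine ⟨⌊(1 + 2 / ε) ^ Module.finrank ℝ E⌋₊, ?_⟩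
    rintro _ ⟨t, ht, rfl⟩
    exact Nat.le_floor (card_le_of_separated_of_subset_closedBall hε t ht.1 ht.2)
  obtain ⟨t, ht, hcard⟩ := Nat.sSup_mem (s := Finset.card '' {t | P t})
    ⟨_, ∅, by simp [P], rfl⟩ hbdd
  refine ⟨t, card_le_of_separated_of_subset_closedBall hε t ht.1 ht.2, ht.1, fun x hx => ?_⟩
  by_contra! hcon
  have hxt : x ∉ t := fun h => by
    have := hcon x h
    rw [sub_self, norm_zero] at this
    linarith
  have hP : P (insert x t) := by
    refine ⟨fun y hy => ?_, fun y hy z hz hyz => ?_⟩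
    · rcases Finset.mem_insert.1 hy with rfl | hy
      · exact hx
      · exact ht.1 y hy
    · rcases Finset.mem_insert.1 hy with hy' | hy' <;> rcases Finset.mem_insert.1 hz with hz' | hz'
      · exact absurd (hy'.trans hz'.symm) hyz
      · rw [hy']; exact hcon z hz'
      · rw [hz', norm_sub_rev]; exact hcon y hy'
      · exact ht.2 y hy' z hz' hyz
  have := le_csSup hbdd ⟨_, hP, rfl⟩
  rw [← hcard, Finset.card_insert_of_notMem hxt] at this
  omega
end

/-! ### Sparse vectors: nets, extension from a net, counting supports. -/

namespace BOP

section
variable {ι : Type*} [Fintype ι]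

lemma l2norm_nonneg {𝕜 : Type*} [RCLike 𝕜] (c : ι → 𝕜) : 0 ≤ l2norm c := norm_nonneg _

lemma l2norm_sq {𝕜 : Type*} [RCLike 𝕜] (c : ι → 𝕜) : l2norm c ^ 2 = ∑ i, ‖c i‖ ^ 2 :=
  EuclideanSpace.norm_sq_eq _

lemma l2norm_smul (a : ℝ) (ha : 0 ≤ a) (c : ι → ℂ) :
    l2norm ((a : ℂ) • c) = a * l2norm c := by
  rw [l2norm, WithLp.toLp_smul, norm_smul, Complex.norm_of_nonneg ha, l2norm]

lemma l2norm_add_le (a b : ι → ℂ) : l2norm (a + b) ≤ l2norm a + l2norm b := by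
  simpa only [l2norm, WithLp.toLp_add] using norm_add_le _ _

lemma l2norm_eq_zero {c : ι → ℂ} : l2norm c = 0 ↔ c = 0 := by
  rw [l2norm, norm_eq_zero]; simp

/-- The vectors supported in `S` form a space of real dimension `2 * S.card`, whence the exponent.
-/
lemma exists_net_sparse {ε : ℝ} (hε : 0 < ε) (S : Finset ι) :
    ∃ t : Finset (ι → ℂ), (t.card : ℝ) ≤ (1 + 2 / ε) ^ (2 * S.card) ∧
      (∀ r ∈ t, Function.support r ⊆ S ∧ l2norm r ≤ 1) ∧
      ∀ r : ι → ℂ, Function.support r ⊆ S → l2norm r ≤ 1 → ∃ y ∈ t, l2norm (r - y) ≤ ε := by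
  classical
  obtain ⟨t, hcard, ht, hnet⟩ := exists_net_closedBall (E := EuclideanSpace ℂ S) hε
  set e : EuclideanSpace ℂ S → ι → ℂ := fun y i => if h : i ∈ S then y ⟨i, h⟩ else 0
  have hsum : ∀ f : ι → ℝ, (∀ i ∉ S, f i = 0) → ∑ i, f i = ∑ i : S, f i := by
    intro f hf
    rw [Finset.sum_coe_sort S f]
    exact (Finset.sum_subset (Finset.subset_univ S) fun i _ hi => hf i hi).symm
  have hnorm : ∀ y, l2norm (e y) = ‖y‖ := by
    intro y
    refine (sq_eq_sq₀ (l2norm_nonneg _) (norm_nonneg _)).1 ?_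
    rw [l2norm_sq, EuclideanSpace.norm_sq_eq, hsum _ fun i hi => by simp [e, hi]]
    simp [e]
  refine ⟨t.image e, ?_, ?_, ?_⟩
  · have : Module.finrank ℝ (EuclideanSpace ℂ S) = 2 * S.card := by
      rw [finrank_real_of_complex]; simp
    rw [this] at hcard
    exact le_trans (by exact_mod_cast Finset.card_image_le) hcard
  · intro r hr
    obtain ⟨y, hy, rfl⟩ := Finset.mem_image.1 hr
    refine ⟨fun i hi => ?_, (hnorm y).trans_le (ht y hy)⟩
    by_contra h
    exact hi (dif_neg (Finset.mem_coe.not.1 h))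
  · intro r hr hr1
    set x : EuclideanSpace ℂ S := WithLp.toLp 2 fun i : S => r i
    have hx : e x = r := by
      ext i
      by_cases h : i ∈ S
      · simp [e, h, x]
      · simp only [e, h, dif_neg, not_false_eq_true]
        exact (Function.notMem_support.1 fun hi => h (hr hi)).symm
    obtain ⟨y, hy, hxy⟩ := hnet x (by rwa [← hnorm, hx])
    refine ⟨e y, Finset.mem_image_of_mem e hy, ?_⟩
    have : r - e y = e (x - y) := by
      rw [← hx]; ext i
      by_cases h : i ∈ S <;> simp [e, h]
    rwa [this, hnorm]

/-- A bound on an `1/2`-net of the sparse unit ball controls a linear map on the subspace. -/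
lemma norm_le_of_net {F : Type*} [NormedAddCommGroup F] [NormedSpace ℂ F]
    (Φ : (ι → ℂ) →ₗ[ℂ] F) (S : Finset ι) (t : Finset (ι → ℂ)) {ε K : ℝ} (hε : ε ≤ 1 / 2)
    (hK : 0 ≤ K) (hS : ∀ r ∈ t, Function.support r ⊆ S)
    (hnet : ∀ r : ι → ℂ, Function.support r ⊆ S → l2norm r ≤ 1 → ∃ y ∈ t, l2norm (r - y) ≤ ε)
    (hΦ : ∀ y ∈ t, ‖Φ y‖ ≤ K) (r : ι → ℂ) (hr : Function.support r ⊆ S) :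
    ‖Φ r‖ ≤ 2 * K * l2norm r := by
  obtain ⟨C, hC0, hC⟩ : ∃ C, 0 ≤ C ∧ ∀ r, ‖Φ r‖ ≤ C * l2norm r := by
    let Ψ : EuclideanSpace ℂ ι →L[ℂ] F := LinearMap.toContinuousLinearMap
      (Φ ∘ₗ (WithLp.linearEquiv 2 ℂ (ι → ℂ)).toLinearMap)
    exact ⟨‖Ψ‖, norm_nonneg _, fun r => Ψ.le_opNorm (WithLp.toLp 2 r)⟩
  -- Any bound `C` improves to `K + C / 2`, because the distance to the net is at most `1/2`.
  -- Iteration from a crude operator norm converges to the fixed point `2 * K`.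
  have step : ∀ C, 0 ≤ C → (∀ r, Function.support r ⊆ S → ‖Φ r‖ ≤ C * l2norm r) →
      ∀ r, Function.support r ⊆ S → ‖Φ r‖ ≤ (K + C / 2) * l2norm r := by
    intro C hC0 hC r hr
    by_cases h0 : r = 0
    · simp [h0, l2norm]
    have hpos : 0 < l2norm r := (l2norm_nonneg r).lt_of_ne' (mt l2norm_eq_zero.1 h0)
    set x : ι → ℂ := ((l2norm r)⁻¹ : ℝ) • r with hx
    have hx' : x = (((l2norm r)⁻¹ : ℝ) : ℂ) • r := by
      ext i; simp [x]
    have hxs : Function.support x ⊆ S := (Function.support_const_smul_subset _ _).trans hr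
    have hx1 : l2norm x = 1 := by
      rw [hx', l2norm_smul _ (by positivity), inv_mul_cancel₀ hpos.ne']
    obtain ⟨y, hy, hxy⟩ := hnet x hxs hx1.le
    have hsub : Function.support (x - y) ⊆ S :=
      (Function.support_sub x y).trans (Set.union_subset hxs (hS y hy))
    have h1 : ‖Φ x‖ ≤ K + C / 2 := by
      have : Φ x = Φ y + Φ (x - y) := by rw [← map_add]; simp
      rw [this]
      refine (norm_add_le _ _).trans (add_le_add (hΦ y hy) ((hC _ hsub).trans ?_))
      nlinarith
    have h2 : ‖Φ r‖ = l2norm r * ‖Φ x‖ := by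
      rw [hx', map_smul, norm_smul, Complex.norm_of_nonneg (by positivity)]
      field_simp
    rw [h2, mul_comm]
    gcongr
  have iter : ∀ n : ℕ, ∀ r, Function.support r ⊆ S →
      ‖Φ r‖ ≤ (2 * K + C * (1 / 2) ^ n) * l2norm r := by
    intro n
    induction n with
    | zero =>
      intro r _
      refine (hC r).trans ?_
      have := l2norm_nonneg r
      gcongr; simp; linarith
    | succ n ih =>
      intro r hr
      refine (step _ (by positivity) ih r hr).trans (le_of_eq ?_)
      rw [pow_succ]; ring
  have ht : Filter.Tendsto (fun n : ℕ => (2 * K + C * (1 / 2 : ℝ) ^ n) * l2norm r) Filter.atTop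
      (nhds ((2 * K + C * 0) * l2norm r)) :=
    (((tendsto_pow_atTop_nhds_zero_of_lt_one (by norm_num) (by norm_num)).const_mul C).const_add
      _).mul_const _
  rw [mul_zero, add_zero] at ht
  exact ge_of_tendsto' ht fun n => iter n r hr
end

/-- Weight each subset by `x ^ S.card`: the total weight is `(1 + x) ^ I.card`, and each set counted
weighs at least `x ^ k`. -/
lemma card_powerset_filter_card_le_mul_pow_le {α : Type*} [DecidableEq α] (I : Finset α) (k : ℕ)
    {x : ℝ} (hx : 0 ≤ x) (hx1 : x ≤ 1) :
    ((I.powerset.filter fun S => S.card ≤ k).card : ℝ) * x ^ k ≤ Real.exp (x * I.card) := by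
  calc ((I.powerset.filter fun S => S.card ≤ k).card : ℝ) * x ^ k
      = ∑ S ∈ I.powerset.filter (fun S => S.card ≤ k), x ^ k := by simp
    _ ≤ ∑ S ∈ I.powerset.filter (fun S => S.card ≤ k), x ^ S.card :=
        Finset.sum_le_sum fun S hS =>
          pow_le_pow_of_le_one hx hx1 (Finset.mem_filter.1 hS).2
    _ ≤ ∑ S ∈ I.powerset, x ^ S.card :=
        Finset.sum_le_sum_of_subset_of_nonneg (Finset.filter_subset _ _)
          fun _ _ _ => by positivity
    _ = (1 + x) ^ I.card := by
        have := Finset.prod_add_one (s := I) (f := fun _ => x)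
        simp only [Finset.prod_const] at this
        rw [add_comm, this]
    _ ≤ Real.exp x ^ I.card := by
        gcongr
        linarith [Real.add_one_le_exp x]
    _ = _ := by rw [← Real.exp_nat_mul, mul_comm]

lemma ncard_indexSet_le {D M d : ℕ} (hd : d ≤ D) (hM : 0 < M) :
    (indexSet D M d).ncard ≤ D.choose d * M ^ d := by
  classical
  have : NeZero M := ⟨hM.ne'⟩
  set e : Finset (Fin D) → Finset (Fin D → Fin M) := fun A =>
    Fintype.piFinset fun i => if i ∈ A then Finset.univ else {0}
  have hsub : indexSet D M d ⊆ ((Finset.univ.powersetCard d).biUnion e : Finset _) := by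
    intro n hn
    have hn' : (Finset.univ.filter fun i => (n i : ℕ) ≠ 0).card ≤ d := by
      have h : {i | (n i : ℕ) ≠ 0}.ncard ≤ d := hn
      rw [Set.ncard_eq_toFinset_card'] at h
      convert h using 2; ext; simp
    obtain ⟨A, hA1, _, hA2⟩ := Finset.exists_subsuperset_card_eq (Finset.subset_univ _) hn'
      (by simpa using hd)
    rw [Finset.coe_biUnion, Set.mem_iUnion₂]
    refine ⟨A, by simpa [Finset.mem_powersetCard] using hA2, ?_⟩
    simp only [e, Finset.mem_coe, Fintype.mem_piFinset]
    intro i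
    split_ifs with h
    · exact Finset.mem_univ _
    · rw [Finset.mem_singleton]
      by_contra h0
      exact h (hA1 (by simpa [Finset.mem_filter, Fin.val_eq_zero_iff] using h0))
  calc (indexSet D M d).ncard ≤ ((Finset.univ.powersetCard d).biUnion e).card := by
        rw [← Set.ncard_coe_finset]
        exact Set.ncard_le_ncard hsub (Finset.finite_toSet _)
    _ ≤ (Finset.univ.powersetCard d).card * M ^ d := by
        refine Finset.card_biUnion_le_card_mul _ _ _ fun A hA => le_of_eq ?_
        simp only [e, Fintype.card_piFinset]
        rw [← Finset.prod_subset (Finset.subset_univ A) fun i _ hi => by simp [hi],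
          Finset.prod_congr rfl fun i hi => by rw [if_pos hi]]
        simp [(Finset.mem_powersetCard.1 hA).2]
    _ = _ := by simp

end BOP
-- From proxy functions to Gaussian forms: orthonormality and restricted isometry.
namespace BOP

lemma insertCoord_self {D : ℕ} {β : Fin D → Type*} (j : Fin D) (a : β j)
    (b : ∀ i : {i : Fin D // i ≠ j}, β i) : insertCoord j a b j = a := by
  simp [insertCoord, Equiv.piSplitAt]

lemma insertCoord_of_ne {D : ℕ} {β : Fin D → Type*} (j : Fin D) (a : β j)
    (b : ∀ i : {i : Fin D // i ≠ j}, β i) (i : {i : Fin D // i ≠ j}) :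
    insertCoord j a b i = b i := by
  simp [insertCoord, Equiv.piSplitAt, i.2]

lemma insertCoord_injective {D : ℕ} {β : Type*} (j : Fin D) :
    Function.Injective fun p : β × ({i : Fin D // i ≠ j} → β) =>
      insertCoord (β := fun _ => β) j p.1 p.2 :=
  (Equiv.piSplitAt j fun _ => β).symm.injective

lemma sum_insertCoord {D M : ℕ} {A : Type*} [AddCommMonoid A] (j : Fin D)
    (f : (Fin D → Fin M) → A) :
    ∑ n, f n = ∑ n : Fin M, ∑ k, f (insertCoord (β := fun _ => Fin M) j n k) := by
  rw [← Fintype.sum_prod_type']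
  exact (Equiv.sum_comp (Equiv.piSplitAt j fun _ => Fin M).symm f).symm

section
variable {E : Type*} [MeasurableSpace E] {M : ℕ} {σ : Measure E} [IsProbabilityMeasure σ]
  {T : Fin M → E → ℂ}

lemma IsBOS.integrable_mul_conj (hT : IsBOS σ T) (k l : Fin M) :
    Integrable (fun x => T k x * (starRingEnd ℂ) (T l x)) σ := by
  obtain ⟨K, hK⟩ := hT.bounded
  refine Integrable.of_bound (C := K * K) ?_ (Filter.Eventually.of_forall fun x => ?_)
  · have := hT.measurable k
    have := hT.measurable l
    fun_prop
  · rw [norm_mul, RCLike.norm_conj]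
    exact mul_le_mul (hK k x) (hK l x) (norm_nonneg _) ((norm_nonneg _).trans (hK k x))

lemma IsBOS.innerL2_sum (hT : IsBOS σ T) (c : Fin M → ℂ) (n : Fin M) :
    innerL2 σ (fun x => ∑ k, c k * T k x) (T n) = c n := by
  simp only [innerL2, Finset.sum_mul, mul_assoc]
  rw [integral_finsetSum _ fun k _ => (hT.integrable_mul_conj k n).const_mul _]
  simp_rw [integral_const_mul, hT.orthonormal]
  simp

lemma IsBOS.energy_sum (hT : IsBOS σ T) (c : Fin M → ℂ) :
    energy σ (fun x => ∑ k, c k * T k x) = ∑ k, ‖c k‖ ^ 2 := by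
  have h : ∀ x, ((‖∑ k, c k * T k x‖ ^ 2 : ℝ) : ℂ) =
      ∑ l, (starRingEnd ℂ) (c l) * ((∑ k, c k * T k x) * (starRingEnd ℂ) (T l x)) := by
    intro x
    push_cast
    rw [← Complex.mul_conj', map_sum, Finset.mul_sum]
    refine Finset.sum_congr rfl fun l _ => ?_
    rw [map_mul]; ring
  have hint : ∀ l, Integrable (fun x => (∑ k, c k * T k x) * (starRingEnd ℂ) (T l x)) σ := by
    intro l
    simp only [Finset.sum_mul, mul_assoc]
    exact integrable_finsetSum _ fun k _ => (hT.integrable_mul_conj k l).const_mul _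
  apply Complex.ofReal_injective
  rw [energy, ← integral_complex_ofReal]
  simp_rw [h]
  rw [integral_finsetSum _ fun l _ => (hint l).const_mul _]
  simp_rw [integral_const_mul]
  push_cast
  refine Finset.sum_congr rfl fun l _ => ?_
  have := hT.innerL2_sum c l
  rw [innerL2] at this
  rw [this, ← Complex.mul_conj', mul_comm]

end

/-- The infimum of an empty set would be the default value `0` and say nothing about `A`; the
operator norm supplies a member. -/
lemma exists_mem_ric_set {ι κ : Type*} [Fintype ι] [Fintype κ] (s : ℕ) (A : Matrix ι κ ℂ) :
    {δ : ℝ | 0 ≤ δ ∧ ∀ c : κ → ℂ, IsSparse s c →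
      (1 - δ) * l2norm c ^ 2 ≤ l2norm (A.mulVec c) ^ 2 ∧
        l2norm (A.mulVec c) ^ 2 ≤ (1 + δ) * l2norm c ^ 2}.Nonempty := by
  classical
  let Ψ := (Matrix.toLpLin 2 2 A).toContinuousLinearMap
  have h : ∀ c, l2norm (A.mulVec c) ≤ ‖Ψ‖ * l2norm c := fun c => Ψ.le_opNorm (WithLp.toLp 2 c)
  refine ⟨1 + ‖Ψ‖ ^ 2, by positivity, fun c _ => ⟨?_, ?_⟩⟩
  · nlinarith [sq_nonneg (l2norm (A.mulVec c)), sq_nonneg (l2norm c),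
      mul_nonneg (sq_nonneg ‖Ψ‖) (sq_nonneg (l2norm c))]
  · have := pow_le_pow_left₀ (l2norm_nonneg _) (h c) 2
    rw [mul_pow] at this
    nlinarith [sq_nonneg (l2norm c)]

lemma bounds_of_ric_lt {ι κ : Type*} [Fintype ι] [Fintype κ] {s : ℕ} {A : Matrix ι κ ℂ} {δ : ℝ}
    (h : ric s A < δ) (c : κ → ℂ) (hc : IsSparse s c) :
    (1 - δ) * l2norm c ^ 2 ≤ l2norm (A.mulVec c) ^ 2 ∧
      l2norm (A.mulVec c) ^ 2 ≤ (1 + δ) * l2norm c ^ 2 := by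
  obtain ⟨δ', ⟨_, h2⟩, h3⟩ := exists_lt_of_csInf_lt (exists_mem_ric_set s A) h
  have := h2 c hc
  constructor <;> nlinarith [sq_nonneg (l2norm c)]

section
variable {D M m d s : ℕ}

lemma sum_l2norm_slice_sq (r : (Fin D → Fin M) → ℂ) (j : Fin D) :
    ∑ n, l2norm (slice r j n) ^ 2 = l2norm r ^ 2 := by
  simp_rw [l2norm_sq]
  rw [sum_insertCoord j]
  rfl

lemma l2norm_slice_le (r : (Fin D → Fin M) → ℂ) (j : Fin D) (n : Fin M) :
    l2norm (slice r j n) ≤ l2norm r := by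
  refine (sq_le_sq₀ (l2norm_nonneg _) (l2norm_nonneg _)).1 ?_
  rw [← sum_l2norm_slice_sq r j]
  exact Finset.single_le_sum (f := fun n => l2norm (slice r j n) ^ 2)
    (fun _ _ => sq_nonneg _) (Finset.mem_univ n)

lemma IsSparse.of_injective {α β : Type*} [Finite α] [Finite β] {f : β → α}
    (hf : Function.Injective f) {c : α → ℂ} (hc : IsSparse s c) : IsSparse s (c ∘ f) := by
  refine le_trans ?_ hc
  have h : (f '' Function.support (c ∘ f)).ncard = (Function.support (c ∘ f)).ncard :=
    Set.ncard_image_of_injective _ hf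
  rw [← h]
  refine Set.ncard_le_ncard ?_ (Set.toFinite _)
  rintro _ ⟨x, hx, rfl⟩
  exact hx

variable {𝒟 : Fin D → Set ℝ}

lemma slice_eq_zero (j : Fin D) (n : Fin M) (r : (Fin D → Fin M) → ℂ)
    (hr : Function.support r ⊆ indexSet D M d) {k : {i : Fin D // i ≠ j} → Fin M}
    (hk : insertCoord (β := fun _ => Fin M) j n k ∉ indexSet D M d) : slice r j n k = 0 :=
  Function.notMem_support.1 fun h => hk (hr h)

lemma restrictedMatrix_mulVec (T : ∀ j, Fin M → 𝒟 j → ℂ) (j : Fin D)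
    (X : Fin m → ∀ i : {i : Fin D // i ≠ j}, 𝒟 i) (n : Fin M) (r : (Fin D → Fin M) → ℂ)
    (hr : Function.support r ⊆ indexSet D M d) :
    (restrictedMatrix d T j X n).mulVec (fun k => slice r j n k) =
      (samplingMatrix T j X).mulVec (slice r j n) := by
  ext l
  refine Fintype.sum_of_injective Subtype.val Subtype.val_injective _
    (fun k => samplingMatrix T j X l k * slice r j n k) (fun k hk => ?_) fun _ => rfl
  rw [slice_eq_zero j n r hr (fun h => hk ⟨⟨k, h⟩, rfl⟩), mul_zero]

lemma l2norm_restrict_slice (j : Fin D) (n : Fin M) (r : (Fin D → Fin M) → ℂ)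
    (hr : Function.support r ⊆ indexSet D M d) :
    l2norm (fun k : {k : {i : Fin D // i ≠ j} → Fin M //
      insertCoord (β := fun _ => Fin M) j n k ∈ indexSet D M d} => slice r j n k) =
      l2norm (slice r j n) := by
  refine (sq_eq_sq₀ (l2norm_nonneg _) (l2norm_nonneg _)).1 ?_
  rw [l2norm_sq, l2norm_sq]
  refine Fintype.sum_of_injective Subtype.val Subtype.val_injective _
    (fun k => ‖slice r j n k‖ ^ 2) (fun k hk => ?_) fun _ => rfl
  simp [slice_eq_zero j n r hr (fun h => hk ⟨⟨k, h⟩, rfl⟩)]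

/-- The slice vanishes on the columns that the restricted matrix omits, and it inherits the sparsity
of `r`. The constants are `1 - 7/16` and `1 + 7/16`. -/
lemma samplingMatrix_bounds (T : ∀ j, Fin M → 𝒟 j → ℂ) (j : Fin D)
    (X : Fin m → ∀ i : {i : Fin D // i ≠ j}, 𝒟 i) (n : Fin M)
    (hric : ric s (restrictedMatrix d T j X n) < 7 / 16)
    (r : (Fin D → Fin M) → ℂ) (hr : r ∈ sparseCoeffs D M d s) :
    9 / 16 * l2norm (slice r j n) ^ 2 ≤
        ∑ l, ‖(samplingMatrix T j X).mulVec (slice r j n) l‖ ^ 2 ∧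
      ∑ l, ‖(samplingMatrix T j X).mulVec (slice r j n) l‖ ^ 2 ≤
        23 / 16 * l2norm (slice r j n) ^ 2 := by
  have h := bounds_of_ric_lt hric (fun k => slice r j n k)
    (hr.2.of_injective (f := fun k : {k : {i : Fin D // i ≠ j} → Fin M //
      insertCoord (β := fun _ => Fin M) j n k ∈ indexSet D M d} =>
        insertCoord (β := fun _ => Fin M) j n k) fun k k' hk => by
      have := insertCoord_injective j (a₁ := (n, k.1)) (a₂ := (n, k'.1)) hk
      exact Subtype.ext (Prod.ext_iff.1 this).2)
  rw [restrictedMatrix_mulVec T j X n r hr.1, l2norm_restrict_slice j n r hr.1,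
    l2norm_sq ((samplingMatrix T j X).mulVec _)] at h
  constructor
  · linarith [h.1]
  · linarith [h.2]

/-- The coefficients of the proxy function in the univariate basis. -/
noncomputable def proxyCoeff (T : ∀ j, Fin M → 𝒟 j → ℂ) (j : Fin D)
    (X : Fin m → ∀ i : {i : Fin D // i ≠ j}, 𝒟 i) (g : Fin m → ℝ) (r : (Fin D → Fin M) → ℂ)
    (n : Fin M) : ℂ :=
  ∑ l, (g l : ℂ) * (samplingMatrix T j X).mulVec (slice r j n) l

lemma proxy_expansion (T : ∀ j, Fin M → 𝒟 j → ℂ) (j : Fin D)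
    (X : Fin m → ∀ i : {i : Fin D // i ≠ j}, 𝒟 i) (g : Fin m → ℝ) (r : (Fin D → Fin M) → ℂ) :
    proxy (expansion T r) j X g = fun x => ∑ n, proxyCoeff T j X g r n * T j n x := by
  ext x
  have h : ∀ l, expansion T r (insertCoord (β := fun i => 𝒟 i) j x (X l)) =
      ∑ n, (∑ k, slice r j n k * ∏ i : {i : Fin D // i ≠ j}, T i (k i) (X l i)) * T j n x := by
    intro l
    rw [expansion, sum_insertCoord j]
    refine Finset.sum_congr rfl fun n _ => ?_
    rw [Finset.sum_mul]
    refine Finset.sum_congr rfl fun k _ => ?_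
    rw [prodBasis, Fintype.prod_eq_mul_prod_subtype_ne _ j]
    simp only [insertCoord_self, insertCoord_of_ne, slice]
    ring
  simp only [proxy, h, proxyCoeff, Matrix.mulVec, dotProduct, samplingMatrix, Finset.mul_sum,
    Finset.sum_mul]
  rw [Finset.sum_comm]
  refine Finset.sum_congr rfl fun n _ => Finset.sum_congr rfl fun l _ =>
    Finset.sum_congr rfl fun k _ => ?_
  ring

variable (T : ∀ j, Fin M → 𝒟 j → ℂ) (j : Fin D) (X : Fin m → ∀ i : {i : Fin D // i ≠ j}, 𝒟 i)

lemma innerL2_proxy {σ : Measure (𝒟 j)} [IsProbabilityMeasure σ] (hT : IsBOS σ (T j))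
    (g : Fin m → ℝ) (r : (Fin D → Fin M) → ℂ) (n : Fin M) :
    innerL2 σ (proxy (expansion T r) j X g) (T j n) = proxyCoeff T j X g r n := by
  rw [proxy_expansion, hT.innerL2_sum]

lemma energy_proxy {σ : Measure (𝒟 j)} [IsProbabilityMeasure σ] (hT : IsBOS σ (T j))
    (g : Fin m → ℝ) (r : (Fin D → Fin M) → ℂ) :
    energy σ (proxy (expansion T r) j X g) = ∑ n, ‖proxyCoeff T j X g r n‖ ^ 2 := by
  rw [proxy_expansion, hT.energy_sum]

/-- The coefficients of all proxy functions, as a linear map of the coefficient vector. -/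
noncomputable def proxyCoeffMap {L : ℕ} (g : Fin L → Fin m → ℝ) :
    ((Fin D → Fin M) → ℂ) →ₗ[ℂ] EuclideanSpace ℂ (Fin L × Fin M) where
  toFun r := WithLp.toLp 2 fun p => proxyCoeff T j X (g p.1) r p.2
  map_add' r r' := by
    ext p
    have : slice (r + r') j p.2 = slice r j p.2 + slice r' j p.2 := rfl
    simp [proxyCoeff, this, Matrix.mulVec_add, mul_add, Finset.sum_add_distrib]
  map_smul' a r := by
    ext p
    have : slice (a • r) j p.2 = a • slice r j p.2 := rfl
    simp [proxyCoeff, this, Matrix.mulVec_smul, Finset.mul_sum, mul_left_comm]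

lemma norm_proxyCoeffMap_sq {L : ℕ} (g : Fin L → Fin m → ℝ) (r : (Fin D → Fin M) → ℂ) :
    ‖proxyCoeffMap T j X g r‖ ^ 2 = ∑ k, ∑ n, ‖proxyCoeff T j X (g k) r n‖ ^ 2 := by
  rw [EuclideanSpace.norm_sq_eq, Fintype.sum_prod_type]
  rfl

end
end BOP
-- Entropy count and the size of `L`.
namespace BOP

section
variable {D M d s : ℕ}

lemma choose_mul_pow_mul_le : D.choose d * M ^ d * d ≤ (D * M) ^ d := by
  calc D.choose d * M ^ d * d ≤ D.choose d * M ^ d * d.factorial := by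
        gcongr; exact Nat.self_le_factorial d
    _ = D.descFactorial d * M ^ d := by rw [Nat.descFactorial_eq_factorial_mul_choose]; ring
    _ ≤ D ^ d * M ^ d := by gcongr; exact Nat.descFactorial_le_pow D d
    _ = _ := (mul_pow _ _ _).symm

/-- Separates the assumed lower bound on `L` into the entropy of sparse supports and `log (1/p)`. -/
lemma log_weight_eq {Q s d : ℕ} (hQ : 0 < Q) (hs : 0 < s) (hd : 0 < d) {p : ℝ} (hp : 0 < p) :
    (s : ℝ) * d * Real.log (Q / ((s * d * p ^ ((1 : ℝ) / s)) ^ ((1 : ℝ) / d))) =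
      s * Real.log ((Q : ℝ) ^ d / (s * d)) - Real.log p := by
  have hQ' : (0 : ℝ) < Q := by exact_mod_cast hQ
  have hs' : (0 : ℝ) < s := by exact_mod_cast hs
  have hd' : (0 : ℝ) < d := by exact_mod_cast hd
  have hpp : 0 < p ^ ((1 : ℝ) / s) := Real.rpow_pos_of_pos hp _
  rw [Real.log_div hQ'.ne' (by positivity), Real.log_rpow (by positivity),
    Real.log_mul (by positivity) hpp.ne', Real.log_rpow hp,
    Real.log_div (by positivity) (by positivity), Real.log_pow]
  field_simp
  ring

/-- The union over `(j, n)` costs `log Q` with `Q = D * M`. It is absorbed by the sparse entropy: `d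
≤ Q ^ (d - 1)` gives `Q ≤ s * x` for `x = Q ^ d / (s * d)`, and `log x ≥ log 2`. -/
lemma log_le_of_two_mul_le {Q : ℕ} (hd : 1 ≤ d) (hs : 1 ≤ s) (hQ : 2 * s * d ≤ Q ^ d) :
    Real.log Q ≤ 3 * (s * Real.log ((Q : ℝ) ^ d / (s * d))) ∧
      0.69 ≤ Real.log ((Q : ℝ) ^ d / (s * d)) := by
  have hQ2 : 2 ≤ Q := by
    by_contra h
    have : Q ^ d ≤ 1 ^ d := Nat.pow_le_pow_left (by omega) d
    nlinarith [one_pow (M := ℕ) d]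
  have hs' : (1 : ℝ) ≤ s := by exact_mod_cast hs
  have hd' : (1 : ℝ) ≤ d := by exact_mod_cast hd
  have hQ' : (2 : ℝ) ≤ Q := by exact_mod_cast hQ2
  set x : ℝ := (Q : ℝ) ^ d / (s * d)
  have hx : 2 ≤ x := by
    rw [le_div_iff₀ (by positivity), ← mul_assoc]
    exact_mod_cast hQ
  have hlog : 0.69 ≤ Real.log x := by
    have := Real.log_two_gt_d9
    have := Real.log_le_log two_pos hx
    norm_num at *; linarith
  refine ⟨?_, hlog⟩
  have hQd : d ≤ Q ^ (d - 1) := by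
    calc d ≤ 2 ^ (d - 1) := by
          have := (d - 1).lt_two_pow_self; omega
      _ ≤ _ := Nat.pow_le_pow_left hQ2 _
  have hle : (Q : ℝ) ≤ x * s := by
    have : (d : ℝ) ≤ (Q : ℝ) ^ (d - 1) := by exact_mod_cast hQd
    have e : x * s = (Q : ℝ) ^ d / d := by simp only [x]; field_simp
    rw [e, le_div_iff₀ (by positivity)]
    calc (Q : ℝ) * d ≤ Q * Q ^ (d - 1) := by gcongr
      _ = Q ^ d := by rw [← pow_succ']; congr 1; omega
  have h1 : Real.log Q ≤ Real.log x + Real.log s := by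
    rw [← Real.log_mul (by positivity) (by positivity)]
    exact Real.log_le_log (by positivity) hle
  have h2 : Real.log s ≤ s := by linarith [Real.log_le_sub_one_of_pos (show (0 : ℝ) < s by linarith)]
  nlinarith

/-- The generating function is used at weight `2 / x` with `x = Q ^ d / (s * d)`; since `I.card ≤ s
* x`, its exponent is at most `2 * s`. -/
lemma card_supports_le {Q : ℕ} (hd : 1 ≤ d) (hs : 1 ≤ s) {α : Type*} [DecidableEq α]
    (I : Finset α) (hI : I.card * d ≤ Q ^ d) (hQ : 2 * s * d ≤ Q ^ d) :
    ((I.powerset.filter fun S => S.card ≤ 2 * s).card : ℝ) ≤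
      Real.exp (2 * s * Real.log ((Q : ℝ) ^ d / (s * d)) + 2 * s) := by
  have hs' : (1 : ℝ) ≤ s := by exact_mod_cast hs
  have hd' : (1 : ℝ) ≤ d := by exact_mod_cast hd
  set x : ℝ := (Q : ℝ) ^ d / (s * d) with hxdef
  have hx : 2 ≤ x := by
    rw [le_div_iff₀ (by positivity), ← mul_assoc]
    exact_mod_cast hQ
  have h := card_powerset_filter_card_le_mul_pow_le I (2 * s) (x := 2 / x) (by positivity)
    (by rw [div_le_one (by linarith)]; exact hx)
  have hI' : 2 / x * I.card ≤ 2 * s := by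
    have : (I.card : ℝ) * d ≤ (Q : ℝ) ^ d := by exact_mod_cast hI
    rw [div_mul_eq_mul_div, div_le_iff₀ (by linarith)]
    have e : s * x = (Q : ℝ) ^ d / d := by simp only [x]; field_simp
    have : (I.card : ℝ) ≤ s * x := by rw [e, le_div_iff₀ (by positivity)]; exact this
    linarith
  have h2 : ((I.powerset.filter fun S => S.card ≤ 2 * s).card : ℝ) * (1 / x) ^ (2 * s) ≤
      Real.exp (2 * s) := by
    refine le_trans ?_ (h.trans (Real.exp_le_exp.2 hI'))
    gcongr
    norm_num
  have h3 : (1 / x) ^ (2 * s) = Real.exp (-(2 * s * Real.log x)) := by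
    have e : -(2 * s * Real.log x) = ((2 * s : ℕ) : ℝ) * (-Real.log x) := by push_cast; ring
    rw [e, Real.exp_nat_mul, Real.exp_neg, Real.exp_log (by linarith), one_div]
  rw [h3, Real.exp_neg, ← div_eq_mul_inv, div_le_iff₀ (Real.exp_pos _), ← Real.exp_add] at h2
  rwa [add_comm]

/-- With `ℓ` the logarithm of `Q ^ d / (s * d)`, all costs are multiples of `s * ℓ`, where `s ≤ s *
ℓ / 0.69`. The factor `3` costs `2`, the supports `2` plus `2 / 0.69`, the pairs `3`, together below
`11`; the nets cost `4 / 0.69 < 6` times `log A`. -/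
lemma union_bound_lt {Q : ℕ} (hd : 1 ≤ d) (hs : 1 ≤ s) {α : Type*} [DecidableEq α]
    (I : Finset α) (hI : I.card * d ≤ Q ^ d) (hQ : 2 * s * d ≤ Q ^ d)
    {A c p : ℝ} (hA : 1 ≤ A) (hc : 0 < c) (hp : 0 < p) (hp1 : p < 1) (L : ℕ)
    (hL : (11 + 6 * Real.log A) / c *
      (s * d * Real.log (Q / ((s * d * p ^ ((1 : ℝ) / s)) ^ ((1 : ℝ) / d)))) ≤ L) :
    3 * ((I.powerset.filter fun S => S.card ≤ 2 * s).card * A ^ (4 * s) * Q) *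
      Real.exp (-(c * L)) < p := by
  obtain ⟨hlogQ, hlog⟩ := log_le_of_two_mul_le hd hs hQ
  have hQ0 : 0 < Q := by
    rcases Nat.eq_zero_or_pos Q with h | h
    · rw [h, zero_pow (by omega)] at hQ
      nlinarith
    · exact h
  have hcard := card_supports_le hd hs I hI hQ
  rw [log_weight_eq hQ0 (by omega) (by omega) hp] at hL
  set ℓ := Real.log ((Q : ℝ) ^ d / (s * d))
  have hs' : (1 : ℝ) ≤ s := by exact_mod_cast hs
  have hlA : 0 ≤ Real.log A := Real.log_nonneg hA
  have hlp : Real.log p < 0 := Real.log_neg hp hp1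
  have hsl : 0.69 * s ≤ s * ℓ := by nlinarith
  have hL' : (11 + 6 * Real.log A) * (s * ℓ - Real.log p) ≤ c * L := by
    rw [div_mul_eq_mul_div, div_le_iff₀ hc] at hL
    linarith
  have e3 : (3 : ℝ) ≤ Real.exp (2 * (s * ℓ)) := by
    have := Real.add_one_le_exp (2 * (s * ℓ))
    have h2 := Real.exp_one_gt_d9
    have h3 : Real.exp (1.38 : ℝ) ≤ Real.exp (2 * (s * ℓ)) := Real.exp_le_exp.2 (by linarith)
    have h4 : Real.exp (1.38 : ℝ) = Real.exp 1 * Real.exp 0.38 := by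
      rw [← Real.exp_add]; norm_num
    have h5 := Real.add_one_le_exp (0.38 : ℝ)
    norm_num at h2 h5
    nlinarith
  have eA : A ^ (4 * s) = Real.exp (4 * s * Real.log A) := by
    have : 4 * s * Real.log A = ((4 * s : ℕ) : ℝ) * Real.log A := by push_cast; ring
    rw [this, Real.exp_nat_mul, Real.exp_log (by linarith)]
  have eQ : (Q : ℝ) ≤ Real.exp (3 * (s * ℓ)) := by
    rw [← Real.exp_log (show (0 : ℝ) < Q by exact_mod_cast hQ0)]
    exact Real.exp_le_exp.2 hlogQ
  calc _ ≤ Real.exp (2 * (s * ℓ)) * (Real.exp (2 * s * ℓ + 2 * s) *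
        Real.exp (4 * s * Real.log A) * Real.exp (3 * (s * ℓ))) * Real.exp (-(c * L)) := by
        rw [eA]; gcongr
    _ = Real.exp (2 * (s * ℓ) + (2 * s * ℓ + 2 * s + 4 * s * Real.log A + 3 * (s * ℓ)) +
        -(c * L)) := by simp only [Real.exp_add]
    _ < Real.exp (Real.log p) := by
        refine Real.exp_lt_exp.2 ?_
        have h1 : (s : ℝ) * Real.log A ≤ 1.5 * (s * ℓ) * Real.log A := by
          refine mul_le_mul_of_nonneg_right ?_ hlA
          linarith
        nlinarith [mul_nonneg hlA (neg_nonneg.2 hlp.le)]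
    _ = p := Real.exp_log hp
end

/-! ### From the net to all sparse vectors, for fixed weights. -/

lemma ncard_setOf_lt_mul_le {κ : Type*} [Fintype κ] (f : κ → ℝ) (hf : ∀ k, 0 ≤ f k) (u : ℝ) :
    ({k | u < f k}.ncard : ℝ) * u ≤ ∑ k, f k := by
  classical
  rw [Set.ncard_eq_toFinset_card', ← nsmul_eq_mul, ← Finset.sum_const]
  calc _ ≤ ∑ k ∈ {k | u < f k}.toFinset, f k :=
        Finset.sum_le_sum fun k hk => by simpa using (Set.mem_toFinset.1 hk).le
    _ ≤ _ := Finset.sum_le_sum_of_subset_of_nonneg (Finset.subset_univ _) fun k _ _ => hf k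

section
variable {D M m d s L : ℕ} {𝒟 : Fin D → Set ℝ}
  (T : ∀ j, Fin M → 𝒟 j → ℂ) (j : Fin D) (X : Fin m → ∀ i : {i : Fin D // i ≠ j}, 𝒟 i)

lemma proxyCoeff_sub (g : Fin m → ℝ) (r r' : (Fin D → Fin M) → ℂ) (n : Fin M) :
    proxyCoeff T j X g (r - r') n = proxyCoeff T j X g r n - proxyCoeff T j X g r' n := by
  have : slice (r - r') j n = slice r j n - slice r' j n := rfl
  simp [proxyCoeff, this, Matrix.mulVec_sub, mul_sub, Finset.sum_sub_distrib]

lemma proxyCoeff_eq_zero (g : Fin m → ℝ) {r : (Fin D → Fin M) → ℂ} {n : Fin M}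
    (h : l2norm (slice r j n) = 0) : proxyCoeff T j X g r n = 0 := by
  simp [proxyCoeff, l2norm_eq_zero.1 h]

/-- The vector that keeps the entries of one slice of `r` only, scaled by `a`. -/
noncomputable def onlySlice (r : (Fin D → Fin M) → ℂ) (n : Fin M) (a : ℂ) :
    (Fin D → Fin M) → ℂ :=
  fun k => if k j = n then a * r k else 0

lemma slice_onlySlice (r : (Fin D → Fin M) → ℂ) (n : Fin M) (a : ℂ) :
    slice (onlySlice j r n a) j n = a • slice r j n := by
  ext k
  simp [slice, onlySlice, insertCoord_self]

lemma l2norm_onlySlice (r : (Fin D → Fin M) → ℂ) (n : Fin M) (a : ℂ) :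
    l2norm (onlySlice j r n a) = l2norm (a • slice r j n) := by
  refine (sq_eq_sq₀ (l2norm_nonneg _) (l2norm_nonneg _)).1 ?_
  rw [← sum_l2norm_slice_sq _ j, Finset.sum_eq_single n, slice_onlySlice]
  · intro n' _ hn'
    have : slice (onlySlice j r n a) j n' = 0 := by
      ext k
      simp [slice, onlySlice, insertCoord_self, hn']
    rw [this, l2norm_eq_zero.2 rfl, zero_pow two_ne_zero]
  · simp

lemma support_onlySlice (r : (Fin D → Fin M) → ℂ) (n : Fin M) (a : ℂ) :
    Function.support (onlySlice j r n a) ⊆ Function.support r := by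
  intro k hk h
  apply hk
  simp only [onlySlice]
  split_ifs
  · rw [h, mul_zero]
  · rfl

lemma proxyCoeff_onlySlice (g : Fin m → ℝ) (r : (Fin D → Fin M) → ℂ) (n : Fin M) (a : ℂ) :
    proxyCoeff T j X g (onlySlice j r n a) n = a * proxyCoeff T j X g r n := by
  simp [proxyCoeff, slice_onlySlice, Matrix.mulVec_smul, Finset.mul_sum, mul_left_comm]

/-- A finite `ε`-net of the vectors of norm at most one supported in `S`. -/
def IsSparseNet (ε : ℝ) (S : Finset (Fin D → Fin M)) (t : Finset ((Fin D → Fin M) → ℂ)) : Prop :=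
  (∀ r ∈ t, Function.support r ⊆ S ∧ l2norm r ≤ 1) ∧
    ∀ r : (Fin D → Fin M) → ℂ, Function.support r ⊆ S → l2norm r ≤ 1 →
      ∃ y ∈ t, l2norm (r - y) ≤ ε

variable {T j X}

lemma sum_energy_le_of_net {S : Finset (Fin D → Fin M)} {t : Finset ((Fin D → Fin M) → ℂ)}
    (ht : IsSparseNet 1e-7 S t) {g : Fin L → Fin m → ℝ}
    (hg : ∀ y ∈ t, ∑ k, ∑ n, ‖proxyCoeff T j X (g k) y n‖ ^ 2 < 16 * L)
    {r : (Fin D → Fin M) → ℂ} (hr : Function.support r ⊆ S) :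
    ∑ k, ∑ n, ‖proxyCoeff T j X (g k) r n‖ ^ 2 ≤ 64 * L * l2norm r ^ 2 := by
  have h := norm_le_of_net (proxyCoeffMap T j X g) S t (K := 4 * √L) (by norm_num) (by positivity)
    (fun r hr => (ht.1 r hr).1) ht.2 (fun y hy => by
      refine le_of_sq_le_sq ?_ (by positivity)
      rw [norm_proxyCoeffMap_sq, mul_pow, Real.sq_sqrt (Nat.cast_nonneg _)]
      have := hg y hy
      norm_num; linarith) r hr
  have h2 := pow_le_pow_left₀ (norm_nonneg _) h 2
  rw [norm_proxyCoeffMap_sq] at h2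
  refine h2.trans (le_of_eq ?_)
  rw [mul_pow, mul_pow, mul_pow, Real.sq_sqrt (Nat.cast_nonneg _)]
  ring

lemma ncard_energy_gt_le {g : Fin L → Fin m → ℝ} {r : (Fin D → Fin M) → ℂ}
    (h : ∑ k, ∑ n, ‖proxyCoeff T j X (g k) r n‖ ^ 2 ≤ 64 * L * l2norm r ^ 2) :
    ({k | 64000 * l2norm r ^ 2 < ∑ n, ‖proxyCoeff T j X (g k) r n‖ ^ 2}.ncard : ℝ) ≤
      0.001 * L := by
  by_cases h0 : l2norm r = 0
  · have : {k | 64000 * l2norm r ^ 2 < ∑ n, ‖proxyCoeff T j X (g k) r n‖ ^ 2} = ∅ := by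
      refine Set.eq_empty_of_forall_notMem fun k hk => ?_
      have hz : ∑ n, ‖proxyCoeff T j X (g k) r n‖ ^ 2 = 0 := by
        refine Finset.sum_eq_zero fun n _ => ?_
        rw [proxyCoeff_eq_zero T j X (g k) (le_antisymm ((l2norm_slice_le r j n).trans h0.le)
          (l2norm_nonneg _)), norm_zero, zero_pow two_ne_zero]
      simp only [Set.mem_ofPred_eq, hz, h0] at hk
      norm_num at hk
    rw [this, Set.ncard_empty]
    norm_num
  have hpos : 0 < l2norm r ^ 2 := by
    have := (l2norm_nonneg r).lt_of_ne' h0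
    positivity
  have := ncard_setOf_lt_mul_le (fun k => ∑ n, ‖proxyCoeff T j X (g k) r n‖ ^ 2)
    (fun k => by positivity) (64000 * l2norm r ^ 2)
  have h2 := this.trans h
  have h3 : ({k | 64000 * l2norm r ^ 2 < ∑ n, ‖proxyCoeff T j X (g k) r n‖ ^ 2}.ncard : ℝ) *
      64000 * l2norm r ^ 2 ≤ 64 * L * l2norm r ^ 2 := by linarith
  have := le_of_mul_le_mul_right h3 hpos
  norm_num; linarith

/-- Approximate the normalized slice by a net point. The approximation error has square sum over `k`
at most `64 * L * 1e-14`, so it exceeds `1e-4` in modulus for at most `6.4e-5 * L` indices; every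
other index good for the net point is good for `r`. -/
lemma ncard_coeff_bad_le {S : Finset (Fin D → Fin M)} {t : Finset ((Fin D → Fin M) → ℂ)}
    (ht : IsSparseNet 1e-7 S t) {g : Fin L → Fin m → ℝ}
    (hg : ∀ y ∈ t, ∑ k, ∑ n, ‖proxyCoeff T j X (g k) y n‖ ^ 2 < 16 * L) {n : Fin M}
    (hg2 : ∀ y ∈ t, ({k | ¬(0.4 * l2norm (slice y j n) ≤ ‖proxyCoeff T j X (g k) y n‖ ∧
      ‖proxyCoeff T j X (g k) y n‖ ≤ 2.24 * l2norm (slice y j n))}.ncard : ℝ) < 0.4965 * L)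
    {r : (Fin D → Fin M) → ℂ} (hr : Function.support r ⊆ S) :
    ({k | ¬(√23 / 12 * l2norm (slice r j n) ≤ ‖proxyCoeff T j X (g k) r n‖ ∧
      ‖proxyCoeff T j X (g k) r n‖ ≤ 9 / 4 * l2norm (slice r j n))}.ncard : ℝ) ≤ 0.4975 * L := by
  by_cases h0 : l2norm (slice r j n) = 0
  · have : {k | ¬(√23 / 12 * l2norm (slice r j n) ≤ ‖proxyCoeff T j X (g k) r n‖ ∧
      ‖proxyCoeff T j X (g k) r n‖ ≤ 9 / 4 * l2norm (slice r j n))} = ∅ := by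
      refine Set.eq_empty_of_forall_notMem fun k hk => hk ?_
      simp [proxyCoeff_eq_zero T j X (g k) h0, h0]
    rw [this, Set.ncard_empty]
    norm_num
  set c := l2norm (slice r j n)
  have hc : 0 < c := (l2norm_nonneg _).lt_of_ne' h0
  -- Both normalized and cleared of the other slices, so that the error is small relative to
  -- `r_{j;n}` itself.
  set r' := onlySlice j r n ((c⁻¹ : ℝ) : ℂ)
  have hr' : Function.support r' ⊆ S := (support_onlySlice j r n _).trans hr
  have hslice : l2norm (((c⁻¹ : ℝ) : ℂ) • slice r j n) = 1 := by
    rw [l2norm_smul _ (by positivity)]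
    exact inv_mul_cancel₀ hc.ne'
  obtain ⟨y, hy, hyr⟩ := ht.2 r' hr' ((l2norm_onlySlice j r n _).trans hslice).le
  have hsub : Function.support (r' - y) ⊆ S :=
    (Function.support_sub r' y).trans (Set.union_subset hr' (ht.1 y hy).1)
  have hE := sum_energy_le_of_net ht hg hsub
  have hspoil := ncard_setOf_lt_mul_le (fun k => ‖proxyCoeff T j X (g k) (r' - y) n‖ ^ 2)
    (fun k => by positivity) 1e-8
  have hspoil2 : ∑ k, ‖proxyCoeff T j X (g k) (r' - y) n‖ ^ 2 ≤ 64 * L * (1e-7) ^ 2 := by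
    calc _ ≤ ∑ k, ∑ n, ‖proxyCoeff T j X (g k) (r' - y) n‖ ^ 2 :=
          Finset.sum_le_sum fun k _ => Finset.single_le_sum
            (f := fun n => ‖proxyCoeff T j X (g k) (r' - y) n‖ ^ 2)
            (fun _ _ => by positivity) (Finset.mem_univ n)
      _ ≤ _ := hE
      _ ≤ _ := by have := l2norm_nonneg (r' - y); gcongr
  have hcy1 : l2norm (slice y j n) ≤ 1 + 1e-7 ∧ 1 - 1e-7 ≤ l2norm (slice y j n) := by
    have h1 : l2norm (slice (r' - y) j n) ≤ 1e-7 := (l2norm_slice_le _ j n).trans hyr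
    have h1' : l2norm (slice (y - r') j n) ≤ 1e-7 := by
      refine le_trans (le_of_eq ?_) h1
      have : slice (y - r') j n = -slice (r' - y) j n := by ext k; simp [slice]
      rw [this, l2norm, l2norm, WithLp.toLp_neg, norm_neg]
    have h2 : l2norm (slice r' j n) = 1 := by rw [slice_onlySlice, hslice]
    have h3 := l2norm_add_le (slice r' j n) (slice (y - r') j n)
    have h4 := l2norm_add_le (slice y j n) (slice (r' - y) j n)
    have e3 : slice r' j n + slice (y - r') j n = slice y j n := by ext k; simp [slice]
    have e4 : slice y j n + slice (r' - y) j n = slice r' j n := by ext k; simp [slice]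
    rw [e3] at h3
    rw [e4] at h4
    constructor <;> linarith
  -- Hence `√23 / 12 < 0.3997`: the gaps to `0.4` below, and from `2.24` to `9/4` above, absorb the
  -- `1e-4` error and the `1e-7` change of the slice norm.
  have hsqrt : √23 ≤ 4.7959 := Real.sqrt_le_iff.2 ⟨by norm_num, by norm_num⟩
  have hcover : {k | ¬(√23 / 12 * c ≤ ‖proxyCoeff T j X (g k) r n‖ ∧
      ‖proxyCoeff T j X (g k) r n‖ ≤ 9 / 4 * c)} ⊆
      {k | ¬(0.4 * l2norm (slice y j n) ≤ ‖proxyCoeff T j X (g k) y n‖ ∧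
        ‖proxyCoeff T j X (g k) y n‖ ≤ 2.24 * l2norm (slice y j n))} ∪
      {k | 1e-8 < ‖proxyCoeff T j X (g k) (r' - y) n‖ ^ 2} := by
    intro k hk
    by_contra hcon
    simp only [Set.mem_union, Set.mem_ofPred_eq, not_or, not_not, not_lt] at hcon
    obtain ⟨⟨ha, hb⟩, hsm⟩ := hcon
    apply hk
    have hsm' : ‖proxyCoeff T j X (g k) (r' - y) n‖ ≤ 1e-4 :=
      le_of_sq_le_sq (hsm.trans (by norm_num)) (by norm_num)
    rw [proxyCoeff_sub] at hsm'
    have hn : ‖proxyCoeff T j X (g k) r n‖ = c * ‖proxyCoeff T j X (g k) r' n‖ := by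
      rw [proxyCoeff_onlySlice, norm_mul, Complex.norm_of_nonneg (by positivity)]
      field_simp
    have h1 := norm_sub_norm_le (proxyCoeff T j X (g k) r' n) (proxyCoeff T j X (g k) y n)
    have h2 := norm_sub_norm_le (proxyCoeff T j X (g k) y n) (proxyCoeff T j X (g k) r' n)
    rw [norm_sub_rev] at h2
    rw [hn]
    constructor
    · rw [mul_comm]
      gcongr
      norm_num at *
      linarith
    · rw [mul_comm]
      gcongr
      norm_num at *
      linarith
  have h1 : ({k | ¬(√23 / 12 * c ≤ ‖proxyCoeff T j X (g k) r n‖ ∧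
      ‖proxyCoeff T j X (g k) r n‖ ≤ 9 / 4 * c)}.ncard : ℝ) ≤
      ({k | ¬(0.4 * l2norm (slice y j n) ≤ ‖proxyCoeff T j X (g k) y n‖ ∧
        ‖proxyCoeff T j X (g k) y n‖ ≤ 2.24 * l2norm (slice y j n))}.ncard : ℝ) +
      ({k | 1e-8 < ‖proxyCoeff T j X (g k) (r' - y) n‖ ^ 2}.ncard : ℝ) := by
    exact_mod_cast (Set.ncard_le_ncard hcover (Set.toFinite _)).trans (Set.ncard_union_le _ _)
  have h2 := hg2 y hy
  have h3 := hspoil.trans hspoil2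
  have : (0 : ℝ) ≤ L := Nat.cast_nonneg _
  norm_num at *
  linarith
end
end BOP
-- Probabilities of the bad events and their union.
namespace BOP

lemma measure_biUnion_le_ofReal {Ω α : Type*} [MeasurableSpace Ω] (μ : Measure Ω) (s : Finset α)
    (E : α → Set Ω) {b : ℝ} (h : ∀ i ∈ s, μ (E i) ≤ ENNReal.ofReal b) :
    μ (⋃ i ∈ s, E i) ≤ ENNReal.ofReal (s.card * b) := by
  refine (measure_biUnion_finset_le s E).trans ((Finset.sum_le_sum h).trans (le_of_eq ?_))
  rw [Finset.sum_const, nsmul_eq_mul, ENNReal.ofReal_mul (Nat.cast_nonneg _),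
    ENNReal.ofReal_natCast]

/-- Subadditivity alone is used, so the uniform good event, an uncountable intersection, need not be
shown measurable. -/
lemma ofReal_one_sub_lt_measure {Ω : Type*} [MeasurableSpace Ω] (μ : Measure Ω)
    [IsProbabilityMeasure μ] {G B : Set Ω} {p q : ℝ} (hGB : ∀ g ∉ B, g ∈ G) (hq : 0 ≤ q)
    (hqp : q < p) (hp : p < 1) (hB : μ B ≤ ENNReal.ofReal q) : ENNReal.ofReal (1 - p) < μ G := by
  by_contra! h
  have h1 : (1 : ℝ≥0∞) ≤ ENNReal.ofReal (q + (1 - p)) := by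
    rw [ENNReal.ofReal_add hq (by linarith), ← measure_univ (μ := μ)]
    refine (measure_mono fun g _ => ?_).trans ((measure_union_le B G).trans (add_le_add hB h))
    by_cases hg : g ∈ B
    · exact Or.inl hg
    · exact Or.inr (hGB g hg)
  rw [ENNReal.one_le_ofReal] at h1
  linarith

lemma measurableSet_not_between {Ω : Type*} [MeasurableSpace Ω] {f : Ω → ℝ} (hf : Measurable f)
    (a b : ℝ) : MeasurableSet {x | ¬(a ≤ f x ∧ f x ≤ b)} :=
  ((measurableSet_le measurable_const hf).inter (measurableSet_le hf measurable_const)).compl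

lemma half_lt_ncard {L : ℕ} (hL : 0 < L) (P : Fin L → Prop) {c : ℝ} (hc : c < 1 / 2)
    (h : ({k | ¬P k}.ncard : ℝ) ≤ c * L) : (L : ℝ) / 2 < ({k | P k}.ncard : ℝ) := by
  have h1 := Set.ncard_add_ncard_compl {k | P k}
  rw [Nat.card_eq_fintype_card, Fintype.card_fin, Set.compl_ofPred] at h1
  have h2 : ({k | P k}.ncard : ℝ) + ({k | ¬P k}.ncard : ℝ) = L := by exact_mod_cast h1
  have : (0 : ℝ) < L := by exact_mod_cast hL
  nlinarith

lemma ncard_setOf_not_and_le {κ : Type*} [Finite κ] (P Q : κ → Prop) :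
    ({k | ¬(P k ∧ Q k)}.ncard : ℝ) ≤ {k | ¬P k}.ncard + {k | ¬Q k}.ncard := by
  have : {k | ¬(P k ∧ Q k)} = {k | ¬P k} ∪ {k | ¬Q k} := by
    ext; simp only [Set.mem_union, Set.mem_ofPred_eq]; tauto
  rw [this]
  exact_mod_cast Set.ncard_union_le _ _

section
variable {D M m d s : ℕ} {𝒟 : Fin D → Set ℝ}
  {T : ∀ j, Fin M → 𝒟 j → ℂ} {j : Fin D} {X : Fin m → ∀ i : {i : Fin D // i ≠ j}, 𝒟 i}

@[fun_prop]
lemma continuous_proxyCoeff (r : (Fin D → Fin M) → ℂ) (n : Fin M) :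
    Continuous fun g : Fin m → ℝ => proxyCoeff T j X g r n := by
  unfold proxyCoeff
  fun_prop

lemma sum_sampling_sq_le (hric : ∀ n, ric s (restrictedMatrix d T j X n) < 7 / 16)
    {r : (Fin D → Fin M) → ℂ} (hr : r ∈ sparseCoeffs D M d s) :
    ∑ n, ∑ l, ‖(samplingMatrix T j X).mulVec (slice r j n) l‖ ^ 2 ≤ 23 / 16 * l2norm r ^ 2 := by
  rw [← sum_l2norm_slice_sq r j, Finset.mul_sum]
  exact Finset.sum_le_sum fun n _ => (samplingMatrix_bounds T j X n (hric n) r hr).2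

lemma measure_energy_ge_le (hric : ∀ n, ric s (restrictedMatrix d T j X n) < 7 / 16)
    {r : (Fin D → Fin M) → ℂ} (hr : r ∈ sparseCoeffs D M d s) (hr0 : r ≠ 0) :
    stdGaussianPi (Fin m) {g | 64000 * l2norm r ^ 2 ≤ ∑ n, ‖proxyCoeff T j X g r n‖ ^ 2} ≤
      ENNReal.ofReal 0.025 := by
  have hpos : 0 < l2norm r ^ 2 := by
    have := (l2norm_nonneg r).lt_of_ne' (mt l2norm_eq_zero.1 hr0)
    positivity
  have h := (lintegral_complex_quadratic_le (ι := Fin m) fun n =>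
    (samplingMatrix T j X).mulVec (slice r j n)).trans
    (ENNReal.ofReal_le_ofReal (sum_sampling_sq_le hric hr))
  have hM := meas_ge_le_lintegral_div (μ := stdGaussianPi (Fin m))
    (f := fun g => ENNReal.ofReal (∑ n, ‖proxyCoeff T j X g r n‖ ^ 2))
    (Measurable.aemeasurable (Measurable.ennreal_ofReal (Continuous.measurable (by fun_prop))))
    (ε := ENNReal.ofReal (64000 * l2norm r ^ 2)) (ENNReal.ofReal_pos.2 (by positivity)).ne'
    ENNReal.ofReal_ne_top
  refine (measure_mono fun g hg => ?_).trans (hM.trans ((ENNReal.div_le_div_right h _).trans ?_))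
  · exact ENNReal.ofReal_le_ofReal hg
  · rw [← ENNReal.ofReal_div_of_pos (by positivity)]
    refine ENNReal.ofReal_le_ofReal ?_
    rw [div_le_iff₀ (by positivity)]
    nlinarith

lemma measure_sum_energy_ge_le (hric : ∀ n, ric s (restrictedMatrix d T j X n) < 7 / 16)
    {r : (Fin D → Fin M) → ℂ} (hr : r ∈ sparseCoeffs D M d s) (hr1 : l2norm r ≤ 1) (L : ℕ) :
    gaussianWeights L m {g | ¬(∑ k, ∑ n, ‖proxyCoeff T j X (g k) r n‖ ^ 2 < 16 * L)} ≤
      ENNReal.ofReal (Real.exp (-L)) := by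
  simp only [not_lt]
  refine measure_pi_sum_complex_quadratic_ge_le (ι := Fin m)
    (fun n => (samplingMatrix T j X).mulVec (slice r j n)) ?_ L
  have := sum_sampling_sq_le hric hr
  nlinarith [l2norm_nonneg r]

lemma measure_coeff_notMem_le (n : Fin M) (hric : ric s (restrictedMatrix d T j X n) < 7 / 16)
    {r : (Fin D → Fin M) → ℂ} (hr : r ∈ sparseCoeffs D M d s) :
    stdGaussianPi (Fin m) {g | ¬(0.4 * l2norm (slice r j n) ≤ ‖proxyCoeff T j X g r n‖ ∧
      ‖proxyCoeff T j X g r n‖ ≤ 2.24 * l2norm (slice r j n))} ≤ ENNReal.ofReal 0.495 := by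
  rcases (l2norm_nonneg (slice r j n)).eq_or_lt with h0 | hpos
  · simp [proxyCoeff_eq_zero T j X _ h0.symm, ← h0]
  · have := samplingMatrix_bounds T j X n hric r hr
    exact stdGaussianPi_norm_linear_notMem_le _ hpos this.1 this.2
end

/-- Outside of an event of small probability, most of the proxy functions are good, uniformly in
the sparse coefficient vector. -/
lemma exists_uniform_bad_set :
    ∃ γ₀ > 0, ∃ c₀ > 0, ∀ c : ℝ, 0 < c → c ≤ c₀ →
      ∀ (D M d s m : ℕ) (𝒟 : Fin D → Set ℝ) (T : ∀ j, Fin M → 𝒟 j → ℂ)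
        (X : ∀ j : Fin D, Fin m → ∀ i : {i : Fin D // i ≠ j}, 𝒟 i),
        1 ≤ d → d ≤ D → 1 ≤ s → 2 * s ≤ D.choose d * M ^ d →
        (∀ j n, ric (2 * s) (restrictedMatrix d T j (X j) n) < 7 / 16) →
        ∀ (p : ℝ) (L : ℕ), 0 < p → p < 1 →
          γ₀ / c * (s * d * Real.log
            ((D * M) / ((s * d * p ^ ((1 : ℝ) / s)) ^ ((1 : ℝ) / d)))) ≤ L →
          ∃ (B : Set (Fin L → Fin m → ℝ)) (q : ℝ), 0 ≤ q ∧ q + Real.exp (-(c * L)) < p ∧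
            gaussianWeights L m B ≤ ENNReal.ofReal q ∧
            ∀ g ∉ B, ∀ r ∈ sparseCoeffs D M d (2 * s), ∀ (j : Fin D) (n : Fin M),
              ({k | ¬(∑ n, ‖proxyCoeff T j (X j) (g k) r n‖ ^ 2 ≤ 64000 * l2norm r ^ 2)}.ncard : ℝ)
                ≤ 0.001 * L ∧
              ({k | ¬(√23 / 12 * l2norm (slice r j n) ≤ ‖proxyCoeff T j (X j) (g k) r n‖ ∧
                ‖proxyCoeff T j (X j) (g k) r n‖ ≤ 9 / 4 * l2norm (slice r j n))}.ncard : ℝ)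
                ≤ 0.4975 * L := by
  obtain ⟨c₁, hc₁, hch⟩ := exists_chernoff (q := 0.495) (β := 0.4965) (by norm_num) (by norm_num)
  set A : ℝ := 1 + 2 / 1e-7
  have hA : 1 ≤ A := by simp only [A]; norm_num
  refine ⟨11 + 6 * Real.log A, by have := Real.log_nonneg hA; positivity, min 1 c₁,
    lt_min one_pos hc₁, ?_⟩
  intro c hc hcc D M d s m 𝒟 T X hd hdD hs hN hric p L hp hp1 hL
  classical
  have hcL1 : Real.exp (-(L : ℝ)) ≤ Real.exp (-(c * L)) := by
    have := hcc.trans (min_le_left _ _)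
    have : c * L ≤ 1 * L := by gcongr
    exact Real.exp_le_exp.2 (by linarith)
  have hcL2 : Real.exp (-(c₁ * L)) ≤ Real.exp (-(c * L)) := by
    have := hcc.trans (min_le_right _ _)
    have : c * L ≤ c₁ * L := by gcongr
    exact Real.exp_le_exp.2 (by linarith)
  have hM : 0 < M := by
    rcases Nat.eq_zero_or_pos M with h | h
    · rw [h, zero_pow (by omega), mul_zero] at hN; omega
    · exact h
  have hD : 0 < D := by omega
  set I : Finset (Fin D → Fin M) := (Set.toFinite (indexSet D M d)).toFinset
  have hI : I.card ≤ D.choose d * M ^ d := by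
    rw [← Set.ncard_eq_toFinset_card]
    exact ncard_indexSet_le hdD hM
  have hY := choose_mul_pow_mul_le (D := D) (M := M) (d := d)
  have hunion := union_bound_lt (Q := D * M) hd hs I ((Nat.mul_le_mul_right d hI).trans hY)
    ((Nat.mul_le_mul_right d hN).trans hY) hA hc hp hp1 L (by push_cast; exact hL)
  set 𝒮 := I.powerset.filter fun S => S.card ≤ 2 * s
  choose t htcard ht1 ht2 using fun S : Finset (Fin D → Fin M) =>
    exists_net_sparse (ε := 1e-7) (by norm_num) S
  have hnet : ∀ S, IsSparseNet 1e-7 S (t S) := fun S => ⟨ht1 S, ht2 S⟩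
  have hmem : ∀ S ∈ 𝒮, ∀ y ∈ t S, y ∈ sparseCoeffs D M d (2 * s) := by
    intro S hS y hy
    obtain ⟨h1, h2⟩ := Finset.mem_filter.1 hS
    refine ⟨fun n hn => ?_, ?_⟩
    · exact (Set.Finite.mem_toFinset _).1 (Finset.mem_powerset.1 h1 ((ht1 S y hy).1 hn))
    · refine le_trans ?_ h2
      rw [← Set.ncard_coe_finset S]
      exact Set.ncard_le_ncard (ht1 S y hy).1 (Finset.finite_toSet _)
  let E₁ (y : (Fin D → Fin M) → ℂ) (j : Fin D) : Set (Fin L → Fin m → ℝ) :=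
    {g | ¬(∑ k, ∑ n, ‖proxyCoeff T j (X j) (g k) y n‖ ^ 2 < 16 * L)}
  let E₂ (y : (Fin D → Fin M) → ℂ) (j : Fin D) (n : Fin M) : Set (Fin L → Fin m → ℝ) :=
    {g | 0.4965 * L ≤ ({k | g k ∈ {g : Fin m → ℝ |
      ¬(0.4 * l2norm (slice y j n) ≤ ‖proxyCoeff T j (X j) g y n‖ ∧
      ‖proxyCoeff T j (X j) g y n‖ ≤ 2.24 * l2norm (slice y j n))}}.ncard : ℝ)}
  have hE₁ : ∀ S ∈ 𝒮, ∀ y ∈ t S, ∀ j,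
      gaussianWeights L m (E₁ y j) ≤ ENNReal.ofReal (Real.exp (-(c * L))) := fun S hS y hy j =>
    (measure_sum_energy_ge_le (hric j) (hmem S hS y hy) (ht1 S y hy).2 L).trans
      (ENNReal.ofReal_le_ofReal hcL1)
  have hE₂ : ∀ S ∈ 𝒮, ∀ y ∈ t S, ∀ j n,
      gaussianWeights L m (E₂ y j n) ≤ ENNReal.ofReal (Real.exp (-(c * L))) := by
    intro S hS y hy j n
    refine (hch (stdGaussianPi (Fin m)) _ L ?_
      (measure_coeff_notMem_le n (hric j n) (hmem S hS y hy))).trans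
      (ENNReal.ofReal_le_ofReal hcL2)
    exact measurableSet_not_between (Continuous.measurable (by fun_prop)) _ _
  set ρ := Real.exp (-(c * L))
  have hρ : 0 < ρ := Real.exp_pos _
  have hD' : (1 : ℝ) ≤ D := by exact_mod_cast hD
  have hM' : (1 : ℝ) ≤ M := by exact_mod_cast hM
  -- Each net point has `D * (1 + M) ≤ 2 * D * M` bad events. The factor `3` in `union_bound_lt`
  -- leaves room for one further event of probability `ρ`.
  refine ⟨⋃ S ∈ 𝒮, ⋃ y ∈ t S, ⋃ j ∈ (Finset.univ : Finset (Fin D)),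
    (E₁ y j ∪ ⋃ n ∈ (Finset.univ : Finset (Fin M)), E₂ y j n),
    𝒮.card * (A ^ (4 * s) * (D * (2 * M * ρ))), by positivity, ?_, ?_, ?_⟩
  · have h𝒮 : (1 : ℝ) ≤ 𝒮.card := by
      have : ∅ ∈ 𝒮 := by simp [𝒮]
      exact_mod_cast Finset.card_pos.2 ⟨_, this⟩
    have hone : 1 ≤ 𝒮.card * A ^ (4 * s) * (D * M) :=
      one_le_mul_of_one_le_of_one_le (one_le_mul_of_one_le_of_one_le h𝒮 (one_le_pow₀ hA))
        (one_le_mul_of_one_le_of_one_le hD' hM')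
    push_cast at hunion
    nlinarith
  · refine measure_biUnion_le_ofReal _ _ _ fun S hS => ?_
    refine (measure_biUnion_le_ofReal _ _ _ fun y hy =>
      (measure_biUnion_le_ofReal (b := 2 * M * ρ) _ _ _ fun j _ => ?_)).trans
      (ENNReal.ofReal_le_ofReal ?_)
    · refine (measure_union_le _ _).trans ((add_le_add (hE₁ S hS y hy j)
        (measure_biUnion_le_ofReal _ _ _ fun n _ => hE₂ S hS y hy j n)).trans ?_)
      rw [← ENNReal.ofReal_add hρ.le (by positivity), Finset.card_univ, Fintype.card_fin]
      exact ENNReal.ofReal_le_ofReal (by nlinarith)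
    · rw [Finset.card_univ, Fintype.card_fin]
      gcongr
      refine (htcard S).trans (pow_le_pow_right₀ hA ?_)
      have := (Finset.mem_filter.1 hS).2
      omega
  · intro g hg r hr j n
    set S : Finset (Fin D → Fin M) := (Set.toFinite (Function.support r)).toFinset
    have hrS : Function.support r ⊆ S := by simp [S]
    have hS : S ∈ 𝒮 := by
      refine Finset.mem_filter.2 ⟨Finset.mem_powerset.2 fun k hk => ?_, ?_⟩
      · exact (Set.Finite.mem_toFinset _).2 (hr.1 ((Set.Finite.mem_toFinset _).1 hk))
      · rw [← Set.ncard_eq_toFinset_card]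
        exact hr.2
    simp only [Set.mem_iUnion, Set.mem_union, not_exists, not_or] at hg
    have h1 : ∀ y ∈ t S, ∑ k, ∑ n, ‖proxyCoeff T j (X j) (g k) y n‖ ^ 2 < 16 * L :=
      fun y hy => not_not.1 (hg S hS y hy j (Finset.mem_univ _)).1
    have h2 : ∀ y ∈ t S,
        ({k | ¬(0.4 * l2norm (slice y j n) ≤ ‖proxyCoeff T j (X j) (g k) y n‖ ∧
        ‖proxyCoeff T j (X j) (g k) y n‖ ≤ 2.24 * l2norm (slice y j n))}.ncard : ℝ) < 0.4965 * L :=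
      fun y hy => not_le.1 ((hg S hS y hy j (Finset.mem_univ _)).2 n (Finset.mem_univ _))
    refine ⟨?_, ncard_coeff_bad_le (hnet S) h1 h2 hrS⟩
    simp only [not_le]
    exact ncard_energy_gt_le (sum_energy_le_of_net (hnet S) h1 hrS)

end BOP
-- The theorem.
theorem theorem4p2 :
    -- the absolute constants
    ∃ (α γ : ℝ) (m₀ : ℕ), 0 < α ∧ 0 < γ ∧
      ∀ (D M d s m : ℕ) (𝒟 : Fin D → Set ℝ) (ν : ∀ j, Measure (𝒟 j))
        (T : ∀ j, Fin M → 𝒟 j → ℂ)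
        (X : ∀ j : Fin D, Fin m → ∀ i : {i : Fin D // i ≠ j}, 𝒟 i) (δ : ℝ),
        1 ≤ d → d ≤ D → 1 ≤ s → 2 * s ≤ D.choose d * M ^ d →
        (∀ j, IsProbabilityMeasure (ν j)) → (∀ j, BOP.IsBOS (ν j) (T j)) →
        0 < δ → δ < 7 / 16 →
        (∀ j n, BOP.ric (2 * s) (BOP.restrictedMatrix d T j (X j) n) ≤ δ) →
        -- the property that defines the constant `α`
        (∀ (L : ℕ) (k : Fin L), ∀ r ∈ BOP.sparseCoeffs D M d (2 * s), r ≠ 0 → ∀ j : Fin D,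
          BOP.gaussianWeights L m
            {g | α * BOP.l2norm r ^ 2 ≤
              BOP.energy (ν j) (BOP.proxy (BOP.expansion T r) j (X j) (g k))} ≤
            ENNReal.ofReal 0.025) ∧
        -- the uniform bounds
        ∀ (p : ℝ) (L : ℕ), 0 < p → p < 1 → Odd L →
          γ * (s * d * Real.log
            ((D * M) / ((s * d * p ^ ((1 : ℝ) / s)) ^ ((1 : ℝ) / d)))) ≤ L →
          (m₀ ≤ m →
            ENNReal.ofReal (1 - p) < BOP.gaussianWeights L m
              {g | ∀ r ∈ BOP.sparseCoeffs D M d (2 * s), ∀ (j : Fin D) (n : Fin M),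
                (L : ℝ) / 2 < ((∑ k, BOP.goodIndicator α ν T X r j n (g k) : ℕ) : ℝ)}) ∧
          ENNReal.ofReal (1 - p) < BOP.gaussianWeights L m
            {g | ∀ r ∈ BOP.sparseCoeffs D M d (2 * s), ∀ (j : Fin D) (n : Fin M),
              (L : ℝ) / 2 < (({k : Fin L |
                BOP.energy (ν j) (BOP.proxy (BOP.expansion T r) j (X j) (g k)) ≤
                    (α + 1) * BOP.l2norm r ^ 2 ∧
                  1 / 3 * BOP.l2norm (BOP.slice r j n) ≤
                    ‖BOP.innerL2 (ν j) (BOP.proxy (BOP.expansion T r) j (X j) (g k)) (T j n)‖ ∧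
                  ‖BOP.innerL2 (ν j) (BOP.proxy (BOP.expansion T r) j (X j) (g k)) (T j n)‖ ≤
                    9 / 2 * BOP.l2norm (BOP.slice r j n)}.ncard : ℕ) : ℝ)} := by

  obtain ⟨γ₀, hγ₀, c₀, hc₀, hbad⟩ := BOP.exists_uniform_bad_set
  obtain ⟨c₁, hc₁, hch⟩ := exists_chernoff (q := 0.0005) (β := 0.001) (by norm_num) (by norm_num)
  obtain ⟨m₀, hm₀⟩ := exists_stdGaussianPi_norm_sq_le (q := 0.0005) (by norm_num)
  -- One rate serves the uniform bad set and the extra event that the weight norms fail too often.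
  set c := min c₀ c₁
  have hc : 0 < c := lt_min hc₀ hc₁
  refine ⟨64000, γ₀ / c, m₀, by norm_num, by positivity, ?_⟩
  intro D M d s m 𝒟 ν T X δ hd hdD hs hN hν hT hδ0 hδ hric
  have hric' : ∀ j n, BOP.ric (2 * s) (BOP.restrictedMatrix d T j (X j) n) < 7 / 16 :=
    fun j n => (hric j n).trans_lt hδ
  refine ⟨?_, ?_⟩
  · intro L k r hr hr0 j
    have hmeas : MeasurableSet {x : Fin m → ℝ | 64000 * BOP.l2norm r ^ 2 ≤
        ∑ n, ‖BOP.proxyCoeff T j (X j) x r n‖ ^ 2} :=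
      measurableSet_le (by fun_prop) (Continuous.measurable (by fun_prop))
    simp_rw [BOP.energy_proxy T j (X j) (hT j)]
    exact ((measurePreserving_eval (fun _ : Fin L => stdGaussianPi (Fin m)) k).measure_preimage
      hmeas.nullMeasurableSet).trans_le (BOP.measure_energy_ge_le (hric' j) hr hr0)
  intro p L hp hp1 hodd hL
  have hLpos : 0 < L := hodd.pos
  obtain ⟨B, q, hq, hqp, hB, hgood⟩ := hbad c hc (min_le_left _ _) D M d s m 𝒟 T X hd hdD hs hN
    hric' p L hp hp1 hL
  have : IsProbabilityMeasure (BOP.gaussianWeights L m) := by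
    unfold BOP.gaussianWeights; infer_instance
  refine ⟨fun hm => ?_, ?_⟩
  · set N : Set (Fin m → ℝ) := {g | ¬((m : ℝ) / 2 ≤ ∑ i, g i ^ 2 ∧ ∑ i, g i ^ 2 ≤ 3 / 2 * m)}
    have hN : MeasurableSet N := BOP.measurableSet_not_between (by fun_prop) _ _
    have hB' := hch (stdGaussianPi (Fin m)) N L hN (hm₀ m hm)
    have hexp : Real.exp (-(c₁ * L)) ≤ Real.exp (-(c * L)) := by
      have : c * L ≤ c₁ * L := by gcongr; exact min_le_right _ _
      exact Real.exp_le_exp.2 (by linarith)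
    refine BOP.ofReal_one_sub_lt_measure _
      (B := B ∪ {g | 0.001 * L ≤ ({k | g k ∈ N}.ncard : ℝ)})
      (q := q + Real.exp (-(c * L))) ?_ (by positivity) hqp hp1 ?_
    · intro g hg r hr j n
      simp only [Set.mem_union, not_or] at hg
      obtain ⟨h1, h2⟩ := hgood g hg.1 r hr j n
      have h3 : ({k | g k ∈ N}.ncard : ℝ) < 0.001 * L := not_le.1 hg.2
      have hsq : ∀ k, BOP.l2norm (g k) ^ 2 = ∑ i, g k i ^ 2 := fun k => by
        simp [BOP.l2norm_sq]
      have hsum : ∀ P : Fin L → Prop, ∀ _ : DecidablePred P,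
          (∑ k, if P k then 1 else 0) = {k | P k}.ncard := fun P _ => by
        rw [Set.ncard_eq_toFinset_card', ← Finset.card_filter]
        congr 1; ext; simp
      simp only [BOP.goodIndicator, BOP.energy_proxy T j (X j) (hT j),
        BOP.innerL2_proxy T j (X j) (hT j), hsq]
      rw [hsum]
      -- `0.001` for the energy, `0.4975` for the coefficient, `0.001` for the norm of the weights.
      refine BOP.half_lt_ncard hLpos _ (c := 0.4995) (by norm_num) ?_
      refine (BOP.ncard_setOf_not_and_le _ _).trans ?_
      have h4 := BOP.ncard_setOf_not_and_le
        (fun k => √23 / 12 * BOP.l2norm (BOP.slice r j n) ≤ ‖BOP.proxyCoeff T j (X j) (g k) r n‖ ∧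
          ‖BOP.proxyCoeff T j (X j) (g k) r n‖ ≤ 9 / 4 * BOP.l2norm (BOP.slice r j n))
        (fun k => (m : ℝ) / 2 ≤ ∑ i, g k i ^ 2 ∧ ∑ i, g k i ^ 2 ≤ 3 / 2 * m)
      refine (add_le_add h1 (h4.trans (add_le_add h2 h3.le))).trans ?_
      norm_num; linarith
    · refine (measure_union_le _ _).trans ?_
      rw [ENNReal.ofReal_add hq (Real.exp_pos _).le]
      exact add_le_add hB (hB'.trans (ENNReal.ofReal_le_ofReal hexp))
  -- No condition on the weight norm here, so no extra event and no lower bound on `m`; the stated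
  -- bounds are weakenings of the uniform ones.
  · refine BOP.ofReal_one_sub_lt_measure _ (B := B) (q := q) ?_ hq
      (by linarith [Real.exp_pos (-(c * L))]) hp1 hB
    intro g hg r hr j n
    obtain ⟨h1, h2⟩ := hgood g hg r hr j n
    simp only [BOP.energy_proxy T j (X j) (hT j), BOP.innerL2_proxy T j (X j) (hT j)]
    refine lt_of_lt_of_le (BOP.half_lt_ncard hLpos
      (fun k => ∑ n, ‖BOP.proxyCoeff T j (X j) (g k) r n‖ ^ 2 ≤ 64000 * BOP.l2norm r ^ 2 ∧
        (√23 / 12 * BOP.l2norm (BOP.slice r j n) ≤ ‖BOP.proxyCoeff T j (X j) (g k) r n‖ ∧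
        ‖BOP.proxyCoeff T j (X j) (g k) r n‖ ≤ 9 / 4 * BOP.l2norm (BOP.slice r j n)))
      (c := 0.4985) (by norm_num) ?_) ?_
    · refine (BOP.ncard_setOf_not_and_le _ _).trans ((add_le_add h1 h2).trans ?_)
      norm_num; linarith
    · refine Nat.cast_le.2 (Set.ncard_le_ncard (fun k hk => ?_) (Set.toFinite _))
      obtain ⟨ha, hb, hc'⟩ := hk
      have hn := BOP.l2norm_nonneg (BOP.slice r j n)
      have hsqrt : (4 : ℝ) ≤ √23 := Real.le_sqrt_of_sq_le (by norm_num)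
      refine ⟨ha.trans (by gcongr; norm_num), le_trans ?_ hb, hc'.trans ?_⟩
      · exact mul_le_mul_of_nonneg_right (by linarith) hn
      · exact mul_le_mul_of_nonneg_right (by norm_num) hn
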